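/- Setting. Let $f:\mathbb R^n\to\mathbb R$ be differentiable, $L$-smooth ($\|\nabla f(x)-\nabla f(y)\|_2\le L\|x-y\|_2$) and $\mu$-strongly convex ($f(x)\ge f(y)+\langle\nabla f(y),x-y\rangle+\frac{\mu}{2}\|x-y\|_2^2$), where $L,\mu>0$, and let $x^*$ be a minimizer of $f$. The function is accessible through stochastic gradients $\nabla f(x,\xi)$ with $\mathbb E_\xi[\nabla f(x,\xi)]=\nabla f(x)$ and $\mathbb E_\xi\|\nabla f(x,\xi)-\nabla f(x)\|_2^2\le\sigma^2$ for all $x$. clipped-SSTM with starting point $x^0$, $N$ iterations, batchsizes $m_k$, stepsize parameter $a$ and clipping parameter $B$: put $A_0=0$, $y^0=z^0=x^0$, and for $k=0,\dots,N-1$ $$\alpha_{k+1}=\tfrac{k+2}{2aL},\quad A_{k+1}=A_k+\alpha_{k+1},\quad \lambda_{k+1}=\tfrac{B}{\alpha_{k+1}},\quad x^{k+1}=\tfrac{A_ky^k+\alpha_{k+1}z^k}{A_{k+1}},$$ $$g^{k}=\tfrac1{m_k}\sum_{i=1}^{m_k}\nabla f(x^{k+1},\xi_i^k),\quad z^{k+1}=z^k-\alpha_{k+1}\min\{1,\lambda_{k+1}/\|g^k\|_2\}\,g^k,\quad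 y^{k+1}=\tfrac{A_ky^k+\alpha_{k+1}z^{k+1}}{A_{k+1}},$$ with fresh i.i.d. samples $\xi_i^k$; the output is $y^N$. R-clipped-SSTM sets $\hat x^0=x^0$ and, for $t=0,1,\dots,\tau-1$, lets $\hat x^{t+1}$ be the output of clipped-SSTM run for $N_0$ iterations from $\hat x^t$ with batchsizes $m^t_k$, stepsize parameter $a$ and clipping parameter $B_t$. Let $\varepsilon>0$, $\beta\in(0,1)$, $N_0\ge1$, $C=\sqrt5$, $R=\sqrt{2(f(x^0)-f(x^*))/\mu}$, $\tau=\max\{0,\lceil\log_2\frac{\mu R^2}{2\varepsilon}\rceil\}$ (with $\tau=0$ if $R=0$), and suppose that, with $\ell=\ln\frac{4N_0\tau}{\beta}$ (so that $\tau\ge1$), $$\ell\ge2,\qquad N_0\ge C\sqrt{\tfrac{8aL}{\mu}},\qquad a\ge\max\Big\{1,\tfrac{16\ell}{C},36\big(2\ell+\sqrt{4\ell^2+2\ell}\big)^2\Big\},$$ $$m_k^t=\Big\lceil\max\Big\{1,\tfrac{6000\cdot2^t\sigma^2\alpha_{k+1}^2N_0\ell}{C^2R^2},\tfrac{10368\cdot2^t\sigma^2\alpha_{k+1}^2N_0}{C^2R^2}\Big\}\Big\rceil,\qquad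 B_t=\frac{CR}{8\cdot2^{t/2}\,\ell},$$ and that $$a=\Theta\Big(\frac{\sigma^4\ln^2\frac{N_0\tau}{\beta}}{L\mu\varepsilon^2}\Big),\qquad N_0=\Theta\Big(\sqrt{\tfrac{aL}{\mu}}\Big).$$ Statement. After $\tau$ runs of clipped-SSTM in R-clipped-SSTM, $f(\hat x^\tau)-f(x^*)\le\varepsilon$ holds with probability at least $1-\beta$. Moreover, the total number $N_0\tau$ of iterations of clipped-SSTM is $$O\Big(\frac{\sigma^2}{\mu\varepsilon}\,\ln\Big(\frac{\mu R^2}{\varepsilon}\Big)\,\max\Big\{1,\ln\Big(\frac{\sigma^2}{\mu\varepsilon\beta}\ln\frac{\mu R^2}{\varepsilon}\Big)\Big\}\Big),$$ and $m_k^t=O(1)$ for all $0\le k<N_0$, $0\le t<\tau$. The constants hidden in these $O(\cdot)$ depend only on the constants in the two $\Theta(\cdot)$ conditions (which may be arbitrary positive numbers), and not on $n$, $f$, $x^0$, the distribution of the noise, or any of the parameters $L,\mu,\sigma,\varepsilon,\beta,a,N_0$. -/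

import Mathlib

open MeasureTheory ProbabilityTheory

namespace ClippedSSTM

/-- `f` is `L`-smooth on `ℝⁿ`: differentiable with `L`-Lipschitz gradient. -/
def IsLSmooth {n : ℕ} (f : EuclideanSpace ℝ (Fin n) → ℝ) (L : ℝ) : Prop :=
  Differentiable ℝ f ∧ ∀ x y, ‖gradient f x - gradient f y‖ ≤ L * ‖x - y‖

/-- The differentiable function `f` is `μ`-strongly convex on `ℝⁿ`. -/
def IsStronglyConvex {n : ℕ} (f : EuclideanSpace ℝ (Fin n) → ℝ) (μ : ℝ) : Prop :=
  Differentiable ℝ f ∧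
    ∀ x y, f y + inner ℝ (gradient f y) (x - y) + μ / 2 * ‖x - y‖ ^ 2 ≤ f x

/-- `G x s` (the stochastic gradient at `x` for the sample `s`, where `s` has law `D`) is an
unbiased estimator of `∇ f x` with variance at most `σ ^ 2`, at every point `x`. -/
structure IsStochasticGradient {n : ℕ} {S : Type*} [MeasurableSpace S]
    (f : EuclideanSpace ℝ (Fin n) → ℝ)
    (G : EuclideanSpace ℝ (Fin n) → S → EuclideanSpace ℝ (Fin n))
    (D : Measure S) (σ : ℝ) : Prop where
  measurable : Measurable (Function.uncurry G)
  integrable : ∀ x, Integrable (G x) D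
  unbiased : ∀ x, ∫ s, G x s ∂D = gradient f x
  integrable_sq : ∀ x, Integrable (fun s => ‖G x s - gradient f x‖ ^ 2) D
  variance_le : ∀ x, ∫ s, ‖G x s - gradient f x‖ ^ 2 ∂D ≤ σ ^ 2

/-- The clipping operator `min {1, l / ‖g‖} g`. -/
noncomputable def clip {n : ℕ} (g : EuclideanSpace ℝ (Fin n)) (l : ℝ) :
    EuclideanSpace ℝ (Fin n) :=
  min 1 (l / ‖g‖) • g

/-- The mini-batched stochastic gradient over the samples `s 0, …, s (m - 1)`. -/
noncomputable def miniBatch {n : ℕ} {S : Type*}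
    (G : EuclideanSpace ℝ (Fin n) → S → EuclideanSpace ℝ (Fin n))
    (m : ℕ) (s : ℕ → S) (x : EuclideanSpace ℝ (Fin n)) : EuclideanSpace ℝ (Fin n) :=
  (m : ℝ)⁻¹ • ∑ i ∈ Finset.range m, G x (s i)

/-- `α₀ = 0` and `α_{k+1} = (k + 2) / (2 a L)`. -/
noncomputable def alpha (a L : ℝ) : ℕ → ℝ
  | 0 => 0
  | k + 1 => ((k : ℝ) + 2) / (2 * a * L)

/-- `A₀ = 0` and `A_{k+1} = A_k + α_{k+1}`. -/
noncomputable def bigA (a L : ℝ) : ℕ → ℝ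
  | 0 => 0
  | k + 1 => bigA a L k + alpha a L (k + 1)

/-- The point `x^{k+1} = (A_k y^k + α_{k+1} z^k) / A_{k+1}`. -/
noncomputable def xPoint {n : ℕ} (a L : ℝ) (k : ℕ) (y z : EuclideanSpace ℝ (Fin n)) :
    EuclideanSpace ℝ (Fin n) :=
  (bigA a L (k + 1))⁻¹ • (bigA a L k • y + alpha a L (k + 1) • z)

/-- The iterates `(y^k, z^k)` of clipped-SSTM from the starting point `x0`, with batchsizes `m k`,
stepsize parameter `a` and clipping parameter `B` (so `λ_{k+1} = B / α_{k+1}`), where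
`s k 0, s k 1, …` are the samples available at iteration `k`. -/
noncomputable def iter {n : ℕ} {S : Type*}
    (G : EuclideanSpace ℝ (Fin n) → S → EuclideanSpace ℝ (Fin n))
    (L a B : ℝ) (m : ℕ → ℕ) (s : ℕ → ℕ → S) (x0 : EuclideanSpace ℝ (Fin n)) :
    ℕ → EuclideanSpace ℝ (Fin n) × EuclideanSpace ℝ (Fin n)
  | 0 => (x0, x0)
  | k + 1 =>
    let y := (iter G L a B m s x0 k).1
    let z := (iter G L a B m s x0 k).2
    let x := xPoint a L k y z
    let g := clip (miniBatch G (m k) (s k) x) (B / alpha a L (k + 1))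
    let z' := z - alpha a L (k + 1) • g
    ((bigA a L (k + 1))⁻¹ • (bigA a L k • y + alpha a L (k + 1) • z'), z')

/-- The points `x̂^t` of R-clipped-SSTM: run `t` of clipped-SSTM makes `N₀` iterations from `x̂^t`
with batchsizes `m t`, clipping parameter `B t` and samples `s t`; its output is `x̂^{t+1}`. -/
noncomputable def restarted {n : ℕ} {S : Type*}
    (G : EuclideanSpace ℝ (Fin n) → S → EuclideanSpace ℝ (Fin n))
    (L a : ℝ) (N₀ : ℕ) (B : ℕ → ℝ) (m : ℕ → ℕ → ℕ) (s : ℕ → ℕ → ℕ → S)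
    (x0 : EuclideanSpace ℝ (Fin n)) : ℕ → EuclideanSpace ℝ (Fin n)
  | 0 => x0
  | t + 1 => (iter G L a (B t) (m t) (s t) (restarted G L a N₀ B m s x0 t) N₀).1

/-- The logarithm `ln (4 N₀ τ / β)`. -/
noncomputable def logFactor (N₀ τ : ℕ) (β : ℝ) : ℝ :=
  Real.log (4 * N₀ * τ / β)

/-- The constant `C = √5`. -/
noncomputable def constC : ℝ := √5

/-- The batchsize `m_k^t`, rounded up to an integer. -/
noncomputable def batchSize (L σ β R a : ℝ) (N₀ τ t k : ℕ) : ℕ :=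
  ⌈max 1 (max
    (6000 * 2 ^ t * σ ^ 2 * alpha a L (k + 1) ^ 2 * N₀ * logFactor N₀ τ β / (constC ^ 2 * R ^ 2))
    (10368 * 2 ^ t * σ ^ 2 * alpha a L (k + 1) ^ 2 * N₀ / (constC ^ 2 * R ^ 2)))⌉₊

/-- The clipping parameter `B_t` of run `t`. -/
noncomputable def clipParam (β R : ℝ) (N₀ τ t : ℕ) : ℝ :=
  constC * R / (8 * (2 : ℝ) ^ ((t : ℝ) / 2) * logFactor N₀ τ β)

/-- The lower bound imposed on the stepsize parameter `a`. -/
noncomputable def aLowerBound (β : ℝ) (N₀ τ : ℕ) : ℝ :=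
  max 1 (max (16 * logFactor N₀ τ β / constC)
    (36 * (2 * logFactor N₀ τ β
      + √(4 * logFactor N₀ τ β ^ 2 + 2 * logFactor N₀ τ β)) ^ 2))

end ClippedSSTM

/-!
Without noise, a step of the accelerated method does not increase the Lyapunov function
`A_k (f y^k - f x*) + ‖z^k - x*‖² / 2`; a clipped stochastic gradient with error `θ` increases it by
at most `stepError`. While `z^k` stays in a ball around `x*` and the exact gradient is at most half
the clipping level, clipping introduces a bias of second order only, so the exponential moment of
the step error is `1 + O(variance)` and a Chernoff bound controls all partial sums of the errors.
To make this unconditional, the errors are replaced by zero outside the safe states. If the partial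
sums of the truncated errors are small, an induction along the run shows that all its states are
safe, so that the truncation was inactive, and quadratic growth turns the resulting bound on the
Lyapunov function into a halving of the gap. The complexity bound holds because
`Λ = ln (N₀ τ / β)` satisfies `exp Λ ≤ q Λ`, hence `Λ ≤ 2 ln q`.
-/

namespace ClippedSSTM

/-! ### Smooth convex functions, clipping and the potential -/

section Smooth

variable {E : Type*} [NormedAddCommGroup E] [InnerProductSpace ℝ E] [CompleteSpace E]
  {f : E → ℝ} {L : ℝ}

lemma hasDerivAt_comp_add_smul (hf : Differentiable ℝ f) (x v : E) (r : ℝ) :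
    HasDerivAt (fun r : ℝ => f (x + r • v)) (inner ℝ (gradient f (x + r • v)) v) r := by
  have hline : HasDerivAt (fun r : ℝ => x + r • v) v r := by
    simpa using ((hasDerivAt_id r).smul_const v).const_add x
  rw [inner_gradient_left]
  exact (hf (x + r • v)).hasFDerivAt.comp_hasDerivAt r hline

lemma le_add_inner_gradient_add_sq_norm (hf : Differentiable ℝ f)
    (hlip : ∀ x y, ‖gradient f x - gradient f y‖ ≤ L * ‖x - y‖) (x v : E) :
    f (x + v) ≤ f x + inner ℝ (gradient f x) v + L / 2 * ‖v‖ ^ 2 := by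
  have hbound : ∀ r : ℝ, 0 ≤ r → inner ℝ (gradient f (x + r • v)) v
      ≤ inner ℝ (gradient f x) v + L * r * ‖v‖ ^ 2 := by
    intro r hr
    have hgrad := hlip (x + r • v) x
    rw [add_sub_cancel_left, norm_smul, Real.norm_of_nonneg hr] at hgrad
    have hinner := real_inner_le_norm (gradient f (x + r • v) - gradient f x) v
    rw [inner_sub_left] at hinner
    linarith [mul_le_mul_of_nonneg_right hgrad (norm_nonneg v)]
  have hquad : ∀ r : ℝ, HasDerivAt
      (fun r => f x + r * inner ℝ (gradient f x) v + L / 2 * r ^ 2 * ‖v‖ ^ 2)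
      (inner ℝ (gradient f x) v + L * r * ‖v‖ ^ 2) r := by
    intro r
    have h := (((hasDerivAt_id r).mul_const (inner ℝ (gradient f x) v)).const_add (f x)).add
      ((((hasDerivAt_id r).pow 2).const_mul (L / 2)).mul_const (‖v‖ ^ 2))
    exact h.congr_deriv (by simp only [id, Nat.cast_ofNat]; ring)
  simpa using image_le_of_deriv_right_le_deriv_boundary (a := 0) (b := 1)
    (fun r _ => (hasDerivAt_comp_add_smul hf x v r).continuousAt.continuousWithinAt)
    (fun r _ => (hasDerivAt_comp_add_smul hf x v r).hasDerivWithinAt) (by simp)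
    (fun r _ => (hquad r).continuousAt.continuousWithinAt)
    (fun r _ => (hquad r).hasDerivWithinAt) (fun r hr => hbound r hr.1)
    (Set.right_mem_Icc.2 zero_le_one)

lemma gradient_step_le (hf : Differentiable ℝ f)
    (hlip : ∀ x y, ‖gradient f x - gradient f y‖ ≤ L * ‖x - y‖) {h : ℝ} (hh : 0 ≤ h)
    (hLh : L * h ≤ 1) (x g : E) :
    f (x - h • g) ≤ f x - h * inner ℝ (gradient f x) g + h / 2 * ‖g‖ ^ 2 := by
  have hdescent := le_add_inner_gradient_add_sq_norm hf hlip x (-(h • g))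
  rw [← sub_eq_add_neg, inner_neg_right, inner_smul_right, norm_neg, norm_smul, mul_pow,
    Real.norm_eq_abs, sq_abs] at hdescent
  nlinarith [mul_le_mul_of_nonneg_right hLh (mul_nonneg hh (sq_nonneg ‖g‖))]

lemma sq_norm_gradient_le (hf : Differentiable ℝ f)
    (hlip : ∀ x y, ‖gradient f x - gradient f y‖ ≤ L * ‖x - y‖) (hL : 0 < L) {fmin : ℝ}
    (hmin : ∀ x, fmin ≤ f x) (x : E) : ‖gradient f x‖ ^ 2 ≤ 2 * L * (f x - fmin) := by
  have hstep := (hmin _).trans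
    (gradient_step_le hf hlip (inv_nonneg.2 hL.le) (mul_inv_cancel₀ hL.ne').le x (gradient f x))
  rw [real_inner_self_eq_norm_sq] at hstep
  calc ‖gradient f x‖ ^ 2 = 2 * L * (L⁻¹ / 2 * ‖gradient f x‖ ^ 2) := by field_simp
    _ ≤ 2 * L * (f x - fmin) := by gcongr; linarith

lemma gradient_eq_zero_of_forall_le {x : E} (hmin : ∀ y, f x ≤ f y) : gradient f x = 0 := by
  have hlocal : IsLocalMin f x := Filter.Eventually.of_forall hmin
  simp [gradient, hlocal.fderiv_eq_zero]

end Smooth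

variable {n : ℕ}

lemma IsLSmooth.continuous_gradient {f : EuclideanSpace ℝ (Fin n) → ℝ} {L : ℝ}
    (hf : IsLSmooth f L) : Continuous (gradient f) :=
  (LipschitzWith.of_dist_le_mul (K := L.toNNReal) fun x y => by
    rw [dist_eq_norm, dist_eq_norm]
    exact (hf.2 x y).trans (by gcongr; exact L.le_coe_toNNReal)).continuous

lemma IsStronglyConvex.mono {f : EuclideanSpace ℝ (Fin n) → ℝ} {μ μ' : ℝ}
    (hf : IsStronglyConvex f μ) (hμ : μ' ≤ μ) : IsStronglyConvex f μ' :=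
  ⟨hf.1, fun x y => le_trans (by gcongr) (hf.2 x y)⟩

lemma IsStronglyConvex.mul_sq_norm_sub_le {f : EuclideanSpace ℝ (Fin n) → ℝ} {μ : ℝ}
    (hf : IsStronglyConvex f μ) {xstar : EuclideanSpace ℝ (Fin n)} (hmin : ∀ y, f xstar ≤ f y)
    (x : EuclideanSpace ℝ (Fin n)) : μ / 2 * ‖x - xstar‖ ^ 2 ≤ f x - f xstar := by
  have h := hf.2 x xstar
  rw [gradient_eq_zero_of_forall_le hmin, inner_zero_left] at h
  linarith

section Clip

variable {g v : EuclideanSpace ℝ (Fin n)} {l : ℝ}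

lemma clip_of_norm_le (h : ‖g‖ ≤ l) : clip g l = g := by
  rcases eq_or_ne g 0 with rfl | hg
  · simp [clip]
  · rw [clip, min_eq_left ((one_le_div (norm_pos_iff.2 hg)).2 h), one_smul]

lemma clip_of_le_norm (h : l ≤ ‖g‖) : clip g l = (l / ‖g‖) • g := by
  rw [clip, min_eq_right (div_le_one_of_le₀ h (norm_nonneg g))]

lemma norm_clip_of_le_norm (hl : 0 ≤ l) (h : l ≤ ‖g‖) : ‖clip g l‖ = l := by
  rcases eq_or_ne g 0 with rfl | hg
  · rw [norm_zero] at h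
    simp [clip, h.antisymm hl]
  · rw [clip_of_le_norm h, norm_smul, Real.norm_of_nonneg (by positivity),
      div_mul_cancel₀ _ (norm_ne_zero_iff.2 hg)]

lemma norm_clip_le (g : EuclideanSpace ℝ (Fin n)) (hl : 0 ≤ l) : ‖clip g l‖ ≤ l := by
  rcases le_total ‖g‖ l with h | h
  · rwa [clip_of_norm_le h]
  · exact (norm_clip_of_le_norm hl h).le

lemma norm_clip_sub_self_of_le_norm (hl : 0 ≤ l) (h : l ≤ ‖g‖) : ‖clip g l - g‖ = ‖g‖ - l := by
  rcases eq_or_ne g 0 with rfl | hg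
  · rw [norm_zero] at h
    simp [clip, h.antisymm hl]
  · have hg' := norm_pos_iff.2 hg
    have heq : clip g l - g = (l / ‖g‖ - 1) • g := by
      rw [clip_of_le_norm h, sub_smul, one_smul]
    rw [heq, norm_smul, Real.norm_of_nonpos (by linarith [(div_le_one hg').2 h])]
    field_simp
    ring

lemma norm_clip_sub_le (g : EuclideanSpace ℝ (Fin n)) (hv : ‖v‖ ≤ l) :
    ‖clip g l - v‖ ≤ ‖g - v‖ := by
  rcases le_total ‖g‖ l with h | h
  · rw [clip_of_norm_le h]
  · have hl := (norm_nonneg v).trans hv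
    rcases eq_or_ne g 0 with rfl | hg
    · simp [clip]
    have hg' := norm_pos_iff.2 hg
    obtain ⟨c, hc, hc0, hc1⟩ : ∃ c : ℝ, c * ‖g‖ = l ∧ 0 ≤ c ∧ c ≤ 1 :=
      ⟨l / ‖g‖, div_mul_cancel₀ _ hg'.ne', by positivity, div_le_one_of_le₀ h hg'.le⟩
    have hinner : inner ℝ g v ≤ ‖g‖ * (c * ‖g‖) :=
      (real_inner_le_norm g v).trans (by rw [hc]; gcongr)
    have hclip : clip g l = c • g := by
      rw [clip_of_le_norm h, ← hc, mul_div_cancel_right₀ _ hg'.ne']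
    refine le_of_sq_le_sq ?_ (norm_nonneg _)
    rw [hclip, norm_sub_sq_real, norm_sub_sq_real, norm_smul, real_inner_smul_left,
      Real.norm_of_nonneg hc0]
    -- The difference of the two sides is `(1 - c) ((1 + c) ‖g‖² - 2 ⟪g, v⟫)`.
    nlinarith [mul_le_mul_of_nonneg_left hinner (sub_nonneg.2 hc1), sq_nonneg ((1 - c) * ‖g‖)]

lemma mul_norm_clip_sub_self_le (g : EuclideanSpace ℝ (Fin n)) (hv : ‖v‖ ≤ l) :
    4 * (l - ‖v‖) * ‖clip g l - g‖ ≤ ‖g - v‖ ^ 2 := by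
  rcases le_total ‖g‖ l with h | h
  · rw [clip_of_norm_le h, sub_self, norm_zero, mul_zero]
    positivity
  · rw [norm_clip_sub_self_of_le_norm ((norm_nonneg v).trans hv) h]
    calc 4 * (l - ‖v‖) * (‖g‖ - l) ≤ (‖g‖ - ‖v‖) ^ 2 := by
          linarith [sq_nonneg ((l - ‖v‖) - (‖g‖ - l))]
      _ ≤ ‖g - v‖ ^ 2 := by gcongr; exacts [by linarith, norm_sub_norm_le g v]

end Clip

section Stepsizes

variable {a L : ℝ}

lemma alpha_succ (a L : ℝ) (k : ℕ) : alpha a L (k + 1) = ((k : ℝ) + 2) / (2 * a * L) := rfl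

lemma bigA_succ (a L : ℝ) (k : ℕ) : bigA a L (k + 1) = bigA a L k + alpha a L (k + 1) := rfl

lemma alpha_succ_pos (ha : 0 < a) (hL : 0 < L) (k : ℕ) : 0 < alpha a L (k + 1) := by
  rw [alpha_succ]; positivity

lemma bigA_eq (a L : ℝ) (k : ℕ) : bigA a L k = k * (k + 3) / (4 * a * L) := by
  induction k with
  | zero => simp [bigA]
  | succ k ih =>
    rw [bigA_succ, ih, alpha_succ]
    push_cast
    ring

lemma bigA_nonneg (ha : 0 < a) (hL : 0 < L) (k : ℕ) : 0 ≤ bigA a L k := by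
  rw [bigA_eq]; positivity

lemma bigA_succ_pos (ha : 0 < a) (hL : 0 < L) (k : ℕ) : 0 < bigA a L (k + 1) :=
  add_pos_of_nonneg_of_pos (bigA_nonneg ha hL k) (alpha_succ_pos ha hL k)

lemma mul_sq_alpha_succ_le_bigA (ha : 1 ≤ a) (hL : 0 < L) (k : ℕ) :
    L * alpha a L (k + 1) ^ 2 ≤ bigA a L (k + 1) := by
  have hk : ((k : ℝ) + 2) ^ 2 ≤ a * ((k + 1) * (k + 4)) := by
    nlinarith [mul_nonneg (sub_nonneg.2 ha) (by positivity : (0 : ℝ) ≤ (k + 1) * (k + 4)),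
      k.cast_nonneg (α := ℝ)]
  calc L * alpha a L (k + 1) ^ 2 = ((k : ℝ) + 2) ^ 2 / (4 * a ^ 2 * L) := by
        rw [alpha_succ]; field_simp; norm_num
    _ ≤ a * ((k + 1) * (k + 4)) / (4 * a ^ 2 * L) := by gcongr
    _ = bigA a L (k + 1) := by rw [bigA_eq]; push_cast; field_simp; ring

end Stepsizes

section Potential

variable {E : Type*} [NormedAddCommGroup E] [InnerProductSpace ℝ E]

/-- The Lyapunov function `A (f y - f xstar) + ‖z - xstar‖² / 2` of a pair `(y, z)` of iterates. -/
noncomputable def potential (f : E → ℝ) (xstar : E) (A : ℝ) (p : E × E) : ℝ :=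
  A * (f p.1 - f xstar) + ‖p.2 - xstar‖ ^ 2 / 2

/-- The increase of the potential that the error `θ` of a gradient estimate can cause in a step of
length `α` from `z`, where `v` is the exact gradient. -/
noncomputable def stepError (xstar : E) (α : ℝ) (z v θ : E) : ℝ :=
  inner ℝ θ (α • (xstar - z) + α ^ 2 • v) + α ^ 2 * ‖θ‖ ^ 2

lemma mul_le_of_linear_coupling {f : E → ℝ} {x y z v xstar : E} {α A : ℝ} (hA : 0 ≤ A)
    (hα : 0 ≤ α) (hx : (A + α) • x = A • y + α • z) (hv : ∀ u, f x + inner ℝ v (u - x) ≤ f u) :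
    (A + α) * f x ≤ A * f y + α * f xstar + α * inner ℝ v (z - xstar) := by
  have hinner : (A + α) * inner ℝ v x = A * inner ℝ v y + α * inner ℝ v z := by
    rw [← inner_smul_right, hx, inner_add_right, inner_smul_right, inner_smul_right]
  have hy := mul_le_mul_of_nonneg_left (hv y) hA
  have hstar := mul_le_mul_of_nonneg_left (hv xstar) hα
  rw [inner_sub_right] at hy hstar ⊢
  linarith

lemma potential_step_le [CompleteSpace E] {f : E → ℝ} {L α A : ℝ} (hf : Differentiable ℝ f)
    (hlip : ∀ x y, ‖gradient f x - gradient f y‖ ≤ L * ‖x - y‖)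
    (hconv : ∀ x y, f y + inner ℝ (gradient f y) (x - y) ≤ f x) (hα : 0 ≤ α) (hA : 0 ≤ A)
    (hA' : 0 < A + α) (hLα : L * α ^ 2 ≤ A + α) {x y z g : E} (xstar : E)
    (hx : x = (A + α)⁻¹ • (A • y + α • z)) :
    potential f xstar (A + α) ((A + α)⁻¹ • (A • y + α • (z - α • g)), z - α • g)
      ≤ potential f xstar A (y, z) + stepError xstar α z (gradient f x) (g - gradient f x) := by
  set v := gradient f x
  have hy : (A + α)⁻¹ • (A • y + α • (z - α • g)) = x - (α ^ 2 / (A + α)) • g := by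
    rw [hx]; module
  have hdescent : (A + α) * f (x - (α ^ 2 / (A + α)) • g)
      ≤ (A + α) * f x - α ^ 2 * inner ℝ v g + α ^ 2 / 2 * ‖g‖ ^ 2 := by
    have hLh : L * (α ^ 2 / (A + α)) ≤ 1 := by rwa [← mul_div_assoc, div_le_one hA']
    calc (A + α) * f (x - (α ^ 2 / (A + α)) • g)
        ≤ (A + α) * (f x - α ^ 2 / (A + α) * inner ℝ v g + α ^ 2 / (A + α) / 2 * ‖g‖ ^ 2) := by
          gcongr; exact gradient_step_le hf hlip (by positivity) hLh x g
      _ = _ := by field_simp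
  have hcoupling := mul_le_of_linear_coupling (xstar := xstar) (f := f) (v := v) hA hα
    (by rw [hx, smul_inv_smul₀ hA'.ne']) (hconv · x)
  have hdist : ‖z - α • g - xstar‖ ^ 2
      = ‖z - xstar‖ ^ 2 - 2 * (α * inner ℝ g (z - xstar)) + α ^ 2 * ‖g‖ ^ 2 := by
    rw [sub_right_comm, norm_sub_sq_real, real_inner_comm, real_inner_smul_left, norm_smul, mul_pow,
      Real.norm_eq_abs, sq_abs]
  have herror : stepError xstar α z v (g - v)
      = α * inner ℝ v (z - xstar) - α * inner ℝ g (z - xstar)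
        + α ^ 2 * (‖g‖ ^ 2 - inner ℝ v g) := by
    rw [stepError, norm_sub_sq_real, ← neg_sub z xstar, real_inner_comm v g]
    simp only [inner_add_right, inner_smul_right, inner_neg_right, inner_sub_left,
      real_inner_self_eq_norm_sq]
    rw [real_inner_comm v g]
    ring
  rw [hy, herror, potential, potential, hdist]
  linarith

end Potential

/-! ### Exponential moments of the clipped noise -/

section Moments

lemma integral_sq_norm_sum_of_indepFun {ι Ω E : Type*} [MeasurableSpace Ω] {P : Measure Ω}
    [IsFiniteMeasure P] [NormedAddCommGroup E] [InnerProductSpace ℝ E] [CompleteSpace E]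
    [MeasurableSpace E] [BorelSpace E] {U : ι → Ω → E} (s : Finset ι)
    (hindep : Pairwise fun i j => U i ⟂ᵢ[P] U j) (hU : ∀ i, MemLp (U i) 2 P)
    (hzero : ∀ i, ∫ ω, U i ω ∂P = 0) :
    ∫ ω, ‖∑ i ∈ s, U i ω‖ ^ 2 ∂P = ∑ i ∈ s, ∫ ω, ‖U i ω‖ ^ 2 ∂P := by
  have hint : ∀ i, Integrable (U i) P := fun i => (hU i).integrable one_le_two
  have hinner : ∀ i j, Integrable (fun ω => inner ℝ (U i ω) (U j ω)) P := by
    intro i j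
    rcases eq_or_ne i j with rfl | hij
    · simpa only [real_inner_self_eq_norm_sq] using (hU i).integrable_norm_pow two_ne_zero
    · exact (hindep hij).integrable_bilin (hint i) (hint j) (innerSL ℝ)
  have horth : ∀ i j, j ≠ i → ∫ ω, inner ℝ (U i ω) (U j ω) ∂P = 0 := fun i j hij =>
    ((hindep hij.symm).integral_bilin (hint i) (hint j) (innerSL ℝ)).trans (by simp [hzero])
  simp only [← real_inner_self_eq_norm_sq, sum_inner, inner_sum]
  rw [integral_finsetSum _ fun i _ => integrable_finsetSum _ fun j _ => hinner j i]
  refine Finset.sum_congr rfl fun i hi => ?_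
  rw [integral_finsetSum _ fun j _ => hinner j i, Finset.sum_eq_single_of_mem i hi]
  exact fun j _ hji => horth j i hji.symm

lemma miniBatch_sub_eq {n : ℕ} {S : Type*}
    {G : EuclideanSpace ℝ (Fin n) → S → EuclideanSpace ℝ (Fin n)} {m : ℕ} (hm : m ≠ 0)
    (s : ℕ → S) (x v : EuclideanSpace ℝ (Fin n)) :
    miniBatch G m s x - v = (m : ℝ)⁻¹ • ∑ i ∈ Finset.range m, (G x (s i) - v) := by
  simp only [miniBatch, Finset.sum_sub_distrib, Finset.sum_const, Finset.card_range, smul_sub]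
  rw [← Nat.cast_smul_eq_nsmul ℝ, inv_smul_smul₀ (Nat.cast_ne_zero.2 hm)]

variable {n : ℕ} {S Ω : Type*} [MeasurableSpace S] [MeasurableSpace Ω] {P : Measure Ω}
  {D : Measure S} {f : EuclideanSpace ℝ (Fin n) → ℝ}
  {G : EuclideanSpace ℝ (Fin n) → S → EuclideanSpace ℝ (Fin n)} {σ : ℝ}

namespace IsStochasticGradient

lemma measurable_sub (hG : IsStochasticGradient f G D σ) (x : EuclideanSpace ℝ (Fin n)) :
    Measurable fun s => G x s - gradient f x :=
  (hG.measurable.comp measurable_prodMk_left).sub_const _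

lemma memLp_sub (hG : IsStochasticGradient f G D σ) (x : EuclideanSpace ℝ (Fin n)) :
    MemLp (fun s => G x s - gradient f x) 2 D :=
  (memLp_two_iff_integrable_sq_norm (hG.measurable_sub x).aestronglyMeasurable).2
    (hG.integrable_sq x)

lemma integral_sub_eq_zero [IsProbabilityMeasure D] (hG : IsStochasticGradient f G D σ)
    (x : EuclideanSpace ℝ (Fin n)) : ∫ s, (G x s - gradient f x) ∂D = 0 := by
  rw [integral_sub (hG.integrable x) (integrable_const _), hG.unbiased]
  simp

variable {ξ : ℕ → Ω → S} {m : ℕ}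

lemma memLp_miniBatch_sub (hG : IsStochasticGradient f G D σ)
    (hξ : ∀ i, MeasurePreserving (ξ i) P D) (hm : m ≠ 0) (x : EuclideanSpace ℝ (Fin n)) :
    MemLp (fun ω => miniBatch G m (fun i => ξ i ω) x - gradient f x) 2 P := by
  simp only [miniBatch_sub_eq hm]
  have hsum : MemLp (fun ω => ∑ i ∈ Finset.range m, (G x (ξ i ω) - gradient f x)) 2 P :=
    memLp_finsetSum _ fun i _ => (hG.memLp_sub x).comp_measurePreserving (hξ i)
  exact hsum.const_smul (m : ℝ)⁻¹

variable [IsProbabilityMeasure P]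

lemma integral_sample_sub_eq_zero (hG : IsStochasticGradient f G D σ) {X : Ω → S}
    (hX : MeasurePreserving X P D) (x : EuclideanSpace ℝ (Fin n)) :
    ∫ ω, (G x (X ω) - gradient f x) ∂P = 0 := by
  have : IsProbabilityMeasure D :=
    hX.map_eq ▸ Measure.isProbabilityMeasure_map hX.measurable.aemeasurable
  rw [← integral_map (f := fun s => G x s - gradient f x) hX.measurable.aemeasurable
    (hG.measurable_sub x).aestronglyMeasurable, hX.map_eq, hG.integral_sub_eq_zero]

lemma integral_miniBatch_sub_eq_zero (hG : IsStochasticGradient f G D σ)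
    (hξ : ∀ i, MeasurePreserving (ξ i) P D) (hm : m ≠ 0) (x : EuclideanSpace ℝ (Fin n)) :
    ∫ ω, (miniBatch G m (fun i => ξ i ω) x - gradient f x) ∂P = 0 := by
  have hint : ∀ i, Integrable (fun ω => G x (ξ i ω) - gradient f x) P := fun i =>
    ((hG.memLp_sub x).comp_measurePreserving (hξ i)).integrable one_le_two
  simp only [miniBatch_sub_eq hm]
  rw [integral_smul, integral_finsetSum _ fun i _ => hint i]
  simp [hG.integral_sample_sub_eq_zero (hξ _)]

lemma integral_sq_norm_miniBatch_sub_le (hG : IsStochasticGradient f G D σ)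
    (hξ : ∀ i, MeasurePreserving (ξ i) P D) (hindep : iIndepFun ξ P) (hm : m ≠ 0)
    (x : EuclideanSpace ℝ (Fin n)) :
    ∫ ω, ‖miniBatch G m (fun i => ξ i ω) x - gradient f x‖ ^ 2 ∂P ≤ σ ^ 2 / m := by
  have hsample : ∀ i, ∫ ω, ‖G x (ξ i ω) - gradient f x‖ ^ 2 ∂P ≤ σ ^ 2 := fun i => by
    rw [← integral_map (f := fun s => ‖G x s - gradient f x‖ ^ 2) (hξ i).measurable.aemeasurable
      ((hG.measurable_sub x).norm.pow_const 2).aestronglyMeasurable, (hξ i).map_eq]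
    exact hG.variance_le x
  have hpair : Pairwise fun i j =>
      (fun ω => G x (ξ i ω) - gradient f x) ⟂ᵢ[P] (fun ω => G x (ξ j ω) - gradient f x) :=
    fun i j hij => (hindep.indepFun hij).comp (hG.measurable_sub x) (hG.measurable_sub x)
  have hsum := integral_sq_norm_sum_of_indepFun (Finset.range m) hpair
    (fun i => (hG.memLp_sub x).comp_measurePreserving (hξ i))
    (fun i => hG.integral_sample_sub_eq_zero (hξ i) x)
  simp only [miniBatch_sub_eq hm, norm_smul, mul_pow, Real.norm_eq_abs, sq_abs]
  rw [integral_const_mul, hsum]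
  calc ((m : ℝ)⁻¹) ^ 2 * ∑ i ∈ Finset.range m, ∫ ω, ‖G x (ξ i ω) - gradient f x‖ ^ 2 ∂P
      ≤ ((m : ℝ)⁻¹) ^ 2 * ∑ _i ∈ Finset.range m, σ ^ 2 := by gcongr; exact hsample _
    _ = σ ^ 2 / m := by
        have : (m : ℝ) ≠ 0 := Nat.cast_ne_zero.2 hm
        rw [Finset.sum_const, Finset.card_range, nsmul_eq_mul]
        field_simp

end IsStochasticGradient

end Moments

section ClippedNoise

variable {n : ℕ} {g v w : EuclideanSpace ℝ (Fin n)} {l W s b : ℝ}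

lemma norm_clip_sub_le_three_halves_mul (hl : 0 ≤ l) (hv : ‖v‖ ≤ l / 2) :
    ‖clip g l - v‖ ≤ 3 / 2 * l := by
  linarith [norm_sub_le (clip g l) v, norm_clip_le g hl]

lemma inner_clip_sub_le (hl : 0 < l) (hv : ‖v‖ ≤ l / 2) (hw : ‖w‖ ≤ W) :
    inner ℝ (clip g l - v) w ≤ inner ℝ (g - v) w + W / (2 * l) * ‖g - v‖ ^ 2 := by
  have : 0 ≤ W := (norm_nonneg w).trans hw
  have hbias : ‖clip g l - g‖ ≤ ‖g - v‖ ^ 2 / (2 * l) := by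
    rw [le_div_iff₀ (by positivity)]
    calc ‖clip g l - g‖ * (2 * l) ≤ 4 * (l - ‖v‖) * ‖clip g l - g‖ := by
          nlinarith [norm_nonneg (clip g l - g)]
      _ ≤ ‖g - v‖ ^ 2 := mul_norm_clip_sub_self_le g (by linarith)
  calc inner ℝ (clip g l - v) w = inner ℝ (g - v) w + inner ℝ (clip g l - g) w := by
        rw [← inner_add_left, sub_add_sub_comm, add_comm g, add_sub_add_right_eq_sub]
    _ ≤ inner ℝ (g - v) w + ‖g - v‖ ^ 2 / (2 * l) * W := by
        gcongr; exact (real_inner_le_norm _ _).trans (by gcongr)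
    _ = _ := by ring

lemma exp_le_one_add_add_sq {x : ℝ} (hx : |x| ≤ 1) : Real.exp x ≤ 1 + x + x ^ 2 := by
  linarith [(abs_le.1 (Real.abs_exp_sub_one_sub_id_le hx)).2]

lemma exp_clip_noise_le (hl : 0 < l) (hv : ‖v‖ ≤ l / 2) (hw : ‖w‖ ≤ W) (hs : 0 ≤ s) (hb : 0 ≤ b)
    (hsl : s * (3 / 2 * l * (W + 3 / 2 * b * l)) ≤ 1) :
    Real.exp (s * (inner ℝ (clip g l - v) w + b * ‖clip g l - v‖ ^ 2))
      ≤ 1 + s * inner ℝ (g - v) w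
        + (s * (W / (2 * l) + b) + (s * (W + 3 / 2 * b * l)) ^ 2) * ‖g - v‖ ^ 2 := by
  have hlin := inner_clip_sub_le (g := g) hl hv hw
  set θ := clip g l - v
  have hW : 0 ≤ W := (norm_nonneg w).trans hw
  have hθl : ‖θ‖ ≤ 3 / 2 * l := norm_clip_sub_le_three_halves_mul hl.le hv
  have hθg : ‖θ‖ ≤ ‖g - v‖ := norm_clip_sub_le g (by linarith)
  have habs : |s * (inner ℝ θ w + b * ‖θ‖ ^ 2)| ≤ s * (‖θ‖ * (W + 3 / 2 * b * l)) := by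
    rw [abs_mul, abs_of_nonneg hs]
    gcongr
    calc |inner ℝ θ w + b * ‖θ‖ ^ 2| ≤ |inner ℝ θ w| + |b * ‖θ‖ ^ 2| := abs_add_le _ _
      _ ≤ ‖θ‖ * W + b * (‖θ‖ * (3 / 2 * l)) := by
        rw [abs_of_nonneg (a := b * ‖θ‖ ^ 2) (by positivity), sq]
        gcongr
        exact (abs_real_inner_le_norm θ w).trans (by gcongr)
      _ = ‖θ‖ * (W + 3 / 2 * b * l) := by ring
  have hone : |s * (inner ℝ θ w + b * ‖θ‖ ^ 2)| ≤ 1 := habs.trans (le_trans (by gcongr) hsl)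
  calc Real.exp (s * (inner ℝ θ w + b * ‖θ‖ ^ 2))
      ≤ 1 + s * (inner ℝ θ w + b * ‖θ‖ ^ 2) + |s * (inner ℝ θ w + b * ‖θ‖ ^ 2)| ^ 2 := by
        rw [sq_abs]; exact exp_le_one_add_add_sq hone
    _ ≤ 1 + s * (inner ℝ (g - v) w + W / (2 * l) * ‖g - v‖ ^ 2 + b * ‖g - v‖ ^ 2)
        + (s * (‖g - v‖ * (W + 3 / 2 * b * l))) ^ 2 := by
        gcongr; exact habs.trans (by gcongr)
    _ = _ := by ring

lemma lintegral_exp_le_of_le_one_add_inner {Ω E : Type*} [MeasurableSpace Ω] {P : Measure Ω}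
    [IsProbabilityMeasure P] [NormedAddCommGroup E] [InnerProductSpace ℝ E] [CompleteSpace E]
    {U : Ω → E} {T : Ω → ℝ} {u : E} {κ V : ℝ} (hU : MemLp U 2 P) (hzero : ∫ ω, U ω ∂P = 0)
    (hV : ∫ ω, ‖U ω‖ ^ 2 ∂P ≤ V) (hκ : 0 ≤ κ)
    (hT : ∀ ω, Real.exp (T ω) ≤ 1 + inner ℝ (U ω) u + κ * ‖U ω‖ ^ 2) :
    ∫⁻ ω, ENNReal.ofReal (Real.exp (T ω)) ∂P ≤ ENNReal.ofReal (Real.exp (κ * V)) := by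
  have hU1 : Integrable U P := hU.integrable one_le_two
  have hsq : Integrable (fun ω => κ * ‖U ω‖ ^ 2) P :=
    (hU.integrable_norm_pow two_ne_zero).const_mul κ
  have hinner : ∫ ω, inner ℝ (U ω) u ∂P = 0 := by
    simp only [real_inner_comm u]
    rw [integral_inner hU1, hzero, inner_zero_right]
  have haff : Integrable (fun ω => 1 + inner ℝ (U ω) u) P :=
    (integrable_const 1).add (hU1.inner_const u)
  have hquad : Integrable (fun ω => 1 + inner ℝ (U ω) u + κ * ‖U ω‖ ^ 2) P := haff.add hsq
  have hmean : ∫ ω, (1 + inner ℝ (U ω) u + κ * ‖U ω‖ ^ 2) ∂P = 1 + κ * ∫ ω, ‖U ω‖ ^ 2 ∂P := by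
    rw [integral_add haff hsq, integral_add (integrable_const 1) (hU1.inner_const u), hinner,
      integral_const_mul]
    simp
  calc ∫⁻ ω, ENNReal.ofReal (Real.exp (T ω)) ∂P
      ≤ ∫⁻ ω, ENNReal.ofReal (1 + inner ℝ (U ω) u + κ * ‖U ω‖ ^ 2) ∂P :=
        lintegral_mono fun ω => ENNReal.ofReal_le_ofReal (hT ω)
    _ = ENNReal.ofReal (1 + κ * ∫ ω, ‖U ω‖ ^ 2 ∂P) := by
        rw [← hmean, ofReal_integral_eq_lintegral_ofReal hquad
          (.of_forall fun ω => (Real.exp_nonneg _).trans (hT ω))]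
    _ ≤ ENNReal.ofReal (Real.exp (κ * V)) := by
        refine ENNReal.ofReal_le_ofReal (le_trans ?_ (Real.add_one_le_exp _))
        rw [add_comm]
        gcongr

end ClippedNoise

section StepErrorMoment

variable {n : ℕ} {xstar z v : EuclideanSpace ℝ (Fin n)} {α ρ ℓ B : ℝ}

lemma norm_step_direction_le (hα : 0 < α) (hz : ‖z - xstar‖ ≤ ρ) (hv : ‖v‖ ≤ B / α / 2) :
    ‖α • (xstar - z) + α ^ 2 • v‖ ≤ α * (ρ + B / 2) := by
  calc ‖α • (xstar - z) + α ^ 2 • v‖ ≤ ‖α • (xstar - z)‖ + ‖α ^ 2 • v‖ := norm_add_le _ _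
    _ = α * ‖z - xstar‖ + α ^ 2 * ‖v‖ := by
        rw [norm_smul, norm_smul, norm_sub_rev, Real.norm_of_nonneg hα.le,
          Real.norm_of_nonneg (sq_nonneg α)]
    _ ≤ α * ρ + α ^ 2 * (B / α / 2) := by gcongr
    _ = _ := by field_simp

lemma exp_stepError_clip_le {g : EuclideanSpace ℝ (Fin n)} (hα : 0 < α) (hρ : 0 < ρ) (hℓ : 2 ≤ ℓ)
    (hB : B = ρ / (8 * ℓ)) (hz : ‖z - xstar‖ ≤ ρ) (hv : ‖v‖ ≤ B / α / 2) :
    Real.exp (4 * ℓ / ρ ^ 2 * stepError xstar α z v (clip g (B / α) - v))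
      ≤ 1 + inner ℝ (g - v) ((4 * ℓ / ρ ^ 2) • (α • (xstar - z) + α ^ 2 • v))
        + 40 * ℓ ^ 2 * α ^ 2 / ρ ^ 2 * ‖g - v‖ ^ 2 := by
  have : 0 < ℓ := by linarith
  have hB0 : 0 < B := by rw [hB]; positivity
  have hsmall : 4 * ℓ / ρ ^ 2 * (3 / 2 * (B / α) * (α * (ρ + B / 2) + 3 / 2 * α ^ 2 * (B / α)))
      ≤ 1 := by
    calc _ = 3 / 4 * (1 + 1 / (4 * ℓ)) := by rw [hB]; field_simp; ring
      _ ≤ 3 / 4 * (1 + 1 / (4 * 2)) := by gcongr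
      _ ≤ 1 := by norm_num
  have hcoef : 4 * ℓ / ρ ^ 2 * (α * (ρ + B / 2) / (2 * (B / α)) + α ^ 2)
      + (4 * ℓ / ρ ^ 2 * (α * (ρ + B / 2) + 3 / 2 * α ^ 2 * (B / α))) ^ 2
      ≤ 40 * ℓ ^ 2 * α ^ 2 / ρ ^ 2 := by
    calc _ = (32 * ℓ ^ 2 + 13 * ℓ + 1) * α ^ 2 / ρ ^ 2 := by rw [hB]; field_simp; ring
      _ ≤ _ := by gcongr; nlinarith
  refine (exp_clip_noise_le (by positivity) hv (norm_step_direction_le hα hz hv) (by positivity)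
    (sq_nonneg α) hsmall).trans ?_
  rw [inner_smul_right]
  gcongr

end StepErrorMoment

/-! ### Sums of adapted errors -/

section AdaptedSums

variable {Ω 𝓧 𝓤 : Type*} {m mΩ : MeasurableSpace Ω} [MeasurableSpace 𝓧] [MeasurableSpace 𝓤]
  {P : Measure Ω}

lemma lintegral_mul_le_of_indep [IsFiniteMeasure P] (hm : m ≤ mΩ) {Z : Ω → ENNReal}
    {X : Ω → 𝓧} {U : Ω → 𝓤} (hZ : Measurable[m] Z) (hX : Measurable[m] X) (hU : Measurable U)
    (hind : Indep m (MeasurableSpace.comap U inferInstance) P) {φ : 𝓧 × 𝓤 → ENNReal}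
    (hφ : Measurable φ) {C : ENNReal} (hC : ∀ x, ∫⁻ ω, φ (x, U ω) ∂P ≤ C) :
    ∫⁻ ω, Z ω * φ (X ω, U ω) ∂P ≤ (∫⁻ ω, Z ω ∂P) * C := by
  have hZX : Measurable[m] fun ω => (Z ω, X ω) := hZ.prodMk hX
  have hZX' : Measurable fun ω => (Z ω, X ω) := hZX.mono hm le_rfl
  have hindep : (fun ω => (Z ω, X ω)) ⟂ᵢ[P] U :=
    (IndepFun_iff_Indep _ _ _).2 (indep_of_indep_of_le_left hind hZX.comap_le)
  have hprod : Measurable fun q : (ENNReal × 𝓧) × 𝓤 => q.1.1 * φ (q.1.2, q.2) := by fun_prop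
  have hsection : ∀ x, ∫⁻ u, φ (x, u) ∂(P.map U) ≤ C := fun x =>
    (lintegral_map (hφ.comp measurable_prodMk_left) hU).trans_le (hC x)
  calc ∫⁻ ω, Z ω * φ (X ω, U ω) ∂P
      = ∫⁻ q, q.1.1 * φ (q.1.2, q.2) ∂((P.map fun ω => (Z ω, X ω)).prod (P.map U)) := by
        rw [← hindep.map_prod_eq_prod_map_map hZX'.aemeasurable hU.aemeasurable,
          lintegral_map hprod (hZX'.prodMk hU)]
    _ = ∫⁻ p, p.1 * ∫⁻ u, φ (p.2, u) ∂(P.map U) ∂(P.map fun ω => (Z ω, X ω)) := by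
        rw [lintegral_prod _ hprod.aemeasurable]
        exact lintegral_congr fun p =>
          lintegral_const_mul p.1 (f := fun u => φ (p.2, u)) (hφ.comp measurable_prodMk_left)
    _ ≤ ∫⁻ p, p.1 * C ∂(P.map fun ω => (Z ω, X ω)) := by gcongr; exact hsection _
    _ = (∫⁻ ω, Z ω ∂P) * C := by
        rw [lintegral_mul_const _ measurable_fst, lintegral_map measurable_fst hZX']

variable {ℱ : Filtration ℕ mΩ} {X : ℕ → Ω → 𝓧} {U : ℕ → Ω → 𝓤} {h : ℕ → 𝓧 × 𝓤 → ℝ} {b r : ℝ}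

lemma measurable_sum_of_adapted (hX : ∀ k, Measurable[ℱ k] (X k))
    (hU : ∀ k, Measurable[ℱ (k + 1)] (U k)) (hh : ∀ k, Measurable (h k)) (k : ℕ) :
    Measurable[ℱ k] fun ω => ∑ i ∈ Finset.range k, h i (X i ω, U i ω) :=
  Finset.measurable_fun_sum _ fun i hi => by
    have hik : i < k := Finset.mem_range.1 hi
    exact (hh i).comp (((hX i).mono (ℱ.mono hik.le) le_rfl).prodMk
      ((hU i).mono (ℱ.mono hik) le_rfl))

variable [IsProbabilityMeasure P]

lemma lintegral_exp_sum_le (hX : ∀ k, Measurable[ℱ k] (X k))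
    (hU : ∀ k, Measurable[ℱ (k + 1)] (U k))
    (hind : ∀ k, Indep (ℱ k) (MeasurableSpace.comap (U k) inferInstance) P)
    (hh : ∀ k, Measurable (h k))
    (hb : ∀ k x, ∫⁻ ω, ENNReal.ofReal (Real.exp (h k (x, U k ω))) ∂P
      ≤ ENNReal.ofReal (Real.exp b)) (k : ℕ) :
    ∫⁻ ω, ENNReal.ofReal (Real.exp (∑ i ∈ Finset.range k, h i (X i ω, U i ω))) ∂P
      ≤ ENNReal.ofReal (Real.exp (k * b)) := by
  induction k with
  | zero => simp
  | succ k ih =>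
    have hsum := (measurable_sum_of_adapted hX hU hh k).exp.ennreal_ofReal
    simp only [Finset.sum_range_succ, Real.exp_add, ENNReal.ofReal_mul (Real.exp_nonneg _)]
    calc _ ≤ (∫⁻ ω, ENNReal.ofReal (Real.exp (∑ i ∈ Finset.range k, h i (X i ω, U i ω))) ∂P)
          * ENNReal.ofReal (Real.exp b) :=
          lintegral_mul_le_of_indep (ℱ.le k) hsum (hX k) ((hU k).mono (ℱ.le (k + 1)) le_rfl)
            (hind k)
            (φ := fun q => ENNReal.ofReal (Real.exp (h k q))) (hh k).exp.ennreal_ofReal (hb k)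
      _ ≤ ENNReal.ofReal (Real.exp (k * b)) * ENNReal.ofReal (Real.exp b) := by gcongr
      _ = ENNReal.ofReal (Real.exp ((k + 1 : ℕ) * b)) := by
          rw [← ENNReal.ofReal_mul (Real.exp_nonneg _), ← Real.exp_add]
          push_cast
          ring_nf

lemma measureReal_lt_sum_le (hX : ∀ k, Measurable[ℱ k] (X k))
    (hU : ∀ k, Measurable[ℱ (k + 1)] (U k))
    (hind : ∀ k, Indep (ℱ k) (MeasurableSpace.comap (U k) inferInstance) P)
    (hh : ∀ k, Measurable (h k))
    (hb : ∀ k x, ∫⁻ ω, ENNReal.ofReal (Real.exp (h k (x, U k ω))) ∂P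
      ≤ ENNReal.ofReal (Real.exp b)) (k : ℕ) :
    P.real {ω | r < ∑ i ∈ Finset.range k, h i (X i ω, U i ω)} ≤ Real.exp (k * b - r) := by
  have hmeas := ((measurable_sum_of_adapted hX hU hh k).mono (ℱ.le k) le_rfl).exp.ennreal_ofReal
  refine ENNReal.toReal_le_of_le_ofReal (Real.exp_nonneg _) ?_
  calc P {ω | r < ∑ i ∈ Finset.range k, h i (X i ω, U i ω)}
      ≤ P {ω | ENNReal.ofReal (Real.exp r)
          ≤ ENNReal.ofReal (Real.exp (∑ i ∈ Finset.range k, h i (X i ω, U i ω)))} :=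
        measure_mono fun ω hω => ENNReal.ofReal_le_ofReal (Real.exp_le_exp.2 (le_of_lt hω))
    _ ≤ (∫⁻ ω, ENNReal.ofReal (Real.exp (∑ i ∈ Finset.range k, h i (X i ω, U i ω))) ∂P)
          / ENNReal.ofReal (Real.exp r) :=
        meas_ge_le_lintegral_div hmeas.aemeasurable (by simp [Real.exp_pos]) ENNReal.ofReal_ne_top
    _ ≤ ENNReal.ofReal (Real.exp (k * b)) / ENNReal.ofReal (Real.exp r) := by
        gcongr; exact lintegral_exp_sum_le hX hU hind hh hb k
    _ = ENNReal.ofReal (Real.exp (k * b - r)) := by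
        rw [← ENNReal.ofReal_div_of_pos (Real.exp_pos _), ← Real.exp_sub]

lemma measureReal_exists_lt_sum_le (hX : ∀ k, Measurable[ℱ k] (X k))
    (hU : ∀ k, Measurable[ℱ (k + 1)] (U k))
    (hind : ∀ k, Indep (ℱ k) (MeasurableSpace.comap (U k) inferInstance) P)
    (hh : ∀ k, Measurable (h k))
    (hb : ∀ k x, ∫⁻ ω, ENNReal.ofReal (Real.exp (h k (x, U k ω))) ∂P
      ≤ ENNReal.ofReal (Real.exp b)) (hb0 : 0 ≤ b) (hr : 0 ≤ r) (N : ℕ) :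
    P.real {ω | ∃ k ≤ N, r < ∑ i ∈ Finset.range k, h i (X i ω, U i ω)}
      ≤ N * Real.exp (N * b - r) := by
  have hcover : {ω | ∃ k ≤ N, r < ∑ i ∈ Finset.range k, h i (X i ω, U i ω)}
      ⊆ ⋃ k ∈ Finset.Ioc 0 N, {ω | r < ∑ i ∈ Finset.range k, h i (X i ω, U i ω)} := by
    rintro ω ⟨k, hk, hω⟩
    have hk0 : k ≠ 0 := by rintro rfl; exact hr.not_gt (by simpa using hω)
    exact Set.mem_biUnion (Finset.mem_Ioc.2 ⟨Nat.pos_of_ne_zero hk0, hk⟩) hω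
  calc P.real {ω | ∃ k ≤ N, r < ∑ i ∈ Finset.range k, h i (X i ω, U i ω)}
      ≤ ∑ k ∈ Finset.Ioc 0 N, P.real {ω | r < ∑ i ∈ Finset.range k, h i (X i ω, U i ω)} :=
        (measureReal_mono hcover (measure_ne_top _ _)).trans (measureReal_biUnion_finset_le _ _)
    _ ≤ ∑ _k ∈ Finset.Ioc 0 N, Real.exp (N * b - r) := by
        refine Finset.sum_le_sum fun k hk => (measureReal_lt_sum_le hX hU hind hh hb k).trans ?_
        have hkN : k ≤ N := (Finset.mem_Ioc.1 hk).2
        gcongr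
    _ = N * Real.exp (N * b - r) := by simp

end AdaptedSums

/-! ### A single run -/

section Run

variable {n : ℕ} {S : Type*}

/-- The clipped gradient estimate used in iteration `k` from the state `p = (y, z)`, with a
mini-batch of size `m` of the samples `u` and clipping parameter `B`. -/
noncomputable def clippedGradient (G : EuclideanSpace ℝ (Fin n) → S → EuclideanSpace ℝ (Fin n))
    (L a B : ℝ) (m k : ℕ) (p : EuclideanSpace ℝ (Fin n) × EuclideanSpace ℝ (Fin n))
    (u : ℕ → S) : EuclideanSpace ℝ (Fin n) :=
  clip (miniBatch G m u (xPoint a L k p.1 p.2)) (B / alpha a L (k + 1))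

/-- The state that follows the state `p = (y, z)` in iteration `k` with gradient estimate `g`. -/
noncomputable def step (a L : ℝ) (k : ℕ)
    (p : EuclideanSpace ℝ (Fin n) × EuclideanSpace ℝ (Fin n)) (g : EuclideanSpace ℝ (Fin n)) :
    EuclideanSpace ℝ (Fin n) × EuclideanSpace ℝ (Fin n) :=
  ((bigA a L (k + 1))⁻¹ • (bigA a L k • p.1 + alpha a L (k + 1) • (p.2 - alpha a L (k + 1) • g)),
    p.2 - alpha a L (k + 1) • g)

/-- The states from which the noise of iteration `k` is controlled: `z` has distance at most `ρ`
from `xstar`, and the exact gradient is at most half the clipping level. -/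
def safeStates (f : EuclideanSpace ℝ (Fin n) → ℝ) (xstar : EuclideanSpace ℝ (Fin n))
    (L a B ρ : ℝ) (k : ℕ) : Set (EuclideanSpace ℝ (Fin n) × EuclideanSpace ℝ (Fin n)) :=
  {p | ‖p.2 - xstar‖ ≤ ρ ∧ ‖gradient f (xPoint a L k p.1 p.2)‖ ≤ B / alpha a L (k + 1) / 2}

/-- The error of iteration `k` from the state `q.1` with samples `q.2`, replaced by zero outside
the safe states, so that its exponential moments are bounded unconditionally. -/
noncomputable def truncError (f : EuclideanSpace ℝ (Fin n) → ℝ)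
    (G : EuclideanSpace ℝ (Fin n) → S → EuclideanSpace ℝ (Fin n))
    (xstar : EuclideanSpace ℝ (Fin n)) (L a B ρ : ℝ) (m k : ℕ)
    (q : (EuclideanSpace ℝ (Fin n) × EuclideanSpace ℝ (Fin n)) × (ℕ → S)) : ℝ :=
  (safeStates f xstar L a B ρ k).indicator (fun p =>
    stepError xstar (alpha a L (k + 1)) p.2 (gradient f (xPoint a L k p.1 p.2))
      (clippedGradient G L a B m k p q.2 - gradient f (xPoint a L k p.1 p.2))) q.1

/-- The sum of the truncated errors of the first `k` iterations of a run. -/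
noncomputable def errorSum (f : EuclideanSpace ℝ (Fin n) → ℝ)
    (G : EuclideanSpace ℝ (Fin n) → S → EuclideanSpace ℝ (Fin n))
    (xstar : EuclideanSpace ℝ (Fin n)) (L a B ρ : ℝ) (m : ℕ → ℕ) (s : ℕ → ℕ → S)
    (x0 : EuclideanSpace ℝ (Fin n)) (k : ℕ) : ℝ :=
  ∑ i ∈ Finset.range k, truncError f G xstar L a B ρ (m i) i (iter G L a B m s x0 i, s i)

variable {f : EuclideanSpace ℝ (Fin n) → ℝ}
  {G : EuclideanSpace ℝ (Fin n) → S → EuclideanSpace ℝ (Fin n)}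
  {x0 xstar y z : EuclideanSpace ℝ (Fin n)}
  {p : EuclideanSpace ℝ (Fin n) × EuclideanSpace ℝ (Fin n)}
  {L a B ρ μ : ℝ} {m : ℕ → ℕ} {s : ℕ → ℕ → S} {k N : ℕ}

lemma iter_succ (G : EuclideanSpace ℝ (Fin n) → S → EuclideanSpace ℝ (Fin n)) (L a B : ℝ)
    (m : ℕ → ℕ) (s : ℕ → ℕ → S) (x0 : EuclideanSpace ℝ (Fin n)) (k : ℕ) :
    iter G L a B m s x0 (k + 1) = step a L k (iter G L a B m s x0 k)
      (clippedGradient G L a B (m k) k (iter G L a B m s x0 k) (s k)) := rfl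

lemma mul_norm_xPoint_sub_le (ha : 0 < a) (hL : 0 < L) (k : ℕ)
    (y z : EuclideanSpace ℝ (Fin n)) : ((k : ℝ) + 2) * ‖xPoint a L k y z - y‖ ≤ 2 * ‖z - y‖ := by
  have hα := alpha_succ_pos ha hL k
  have hA := bigA_succ_pos ha hL k
  have hsub : xPoint a L k y z - y = (alpha a L (k + 1) / bigA a L (k + 1)) • (z - y) := by
    have hcomb : bigA a L k • y + alpha a L (k + 1) • z
        = bigA a L (k + 1) • y + alpha a L (k + 1) • (z - y) := by rw [bigA_succ]; module
    rw [xPoint, hcomb, smul_add, inv_smul_smul₀ hA.ne', add_sub_cancel_left, smul_smul,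
      div_eq_inv_mul]
  have hratio : ((k : ℝ) + 2) * (alpha a L (k + 1) / bigA a L (k + 1)) ≤ 2 := by
    have heq : ((k : ℝ) + 2) * (alpha a L (k + 1) / bigA a L (k + 1))
        = 2 * (k + 2) ^ 2 / ((k + 1) * (k + 4)) := by
      rw [bigA_eq, alpha_succ]
      push_cast
      field_simp
      ring
    rw [heq, div_le_iff₀ (by positivity)]
    nlinarith [k.cast_nonneg (α := ℝ)]
  rw [hsub, norm_smul, Real.norm_of_nonneg (by positivity), ← mul_assoc]
  gcongr

lemma mul_norm_gradient_le_of_bigA_mul_le (hf : IsLSmooth f L) (hL : 0 < L)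
    (hmin : ∀ x, f xstar ≤ f x) (ha : 1 ≤ a) (hρ : 0 ≤ ρ) (hy : ‖y - xstar‖ ≤ ρ)
    (hfy : bigA a L k * (f y - f xstar) ≤ ρ ^ 2 / 2) :
    ((k : ℝ) + 2) * ‖gradient f y‖ ≤ 3 * √a * L * ρ := by
  rcases k.eq_zero_or_pos with rfl | hk
  · have hgrad : ‖gradient f y‖ ≤ L * ρ := by
      have hlip := hf.2 y xstar
      rw [gradient_eq_zero_of_forall_le hmin, sub_zero] at hlip
      exact hlip.trans (by gcongr)
    have hsqrt : 1 ≤ √a := Real.one_le_sqrt.2 ha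
    calc (((0 : ℕ) : ℝ) + 2) * ‖gradient f y‖ ≤ 3 * 1 * (L * ρ) := by
          push_cast; nlinarith [norm_nonneg (gradient f y)]
      _ ≤ 3 * √a * (L * ρ) := by gcongr
      _ = 3 * √a * L * ρ := by ring
  · have hk1 : (1 : ℝ) ≤ k := by exact_mod_cast hk
    have hgap : 0 ≤ f y - f xstar := sub_nonneg.2 (hmin y)
    rw [bigA_eq, div_mul_eq_mul_div, div_le_iff₀ (by positivity)] at hfy
    refine le_of_sq_le_sq ?_ (by positivity)
    calc (((k : ℝ) + 2) * ‖gradient f y‖) ^ 2 = (k + 2) ^ 2 * ‖gradient f y‖ ^ 2 := by ring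
      _ ≤ 9 / 4 * (k * (k + 3)) * (2 * L * (f y - f xstar)) := by
          gcongr
          exacts [by nlinarith, sq_norm_gradient_le hf.1 hf.2 hL hmin y]
      _ = 9 / 2 * L * (k * (k + 3) * (f y - f xstar)) := by ring
      _ ≤ 9 / 2 * L * (ρ ^ 2 / 2 * (4 * a * L)) := by gcongr
      _ = (3 * √a * L * ρ) ^ 2 := by
          rw [mul_pow, mul_pow, mul_pow, Real.sq_sqrt (by linarith)]; ring

lemma mem_safeStates (hf : IsLSmooth f L) (hL : 0 < L) (hmin : ∀ x, f xstar ≤ f x) (ha : 1 ≤ a)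
    (hB : ρ * (4 + 3 * √a) ≤ B * a) (hy : ‖p.1 - xstar‖ ≤ ρ) (hz : ‖p.2 - xstar‖ ≤ ρ)
    (hfy : bigA a L k * (f p.1 - f xstar) ≤ ρ ^ 2 / 2) : p ∈ safeStates f xstar L a B ρ k := by
  refine ⟨hz, ?_⟩
  have ha0 : 0 < a := by linarith
  have hlevel : B / alpha a L (k + 1) / 2 = B * a * L / (k + 2) := by
    rw [alpha_succ]; field_simp
  have hzy : ‖p.2 - p.1‖ ≤ 2 * ρ := by
    calc ‖p.2 - p.1‖ ≤ ‖p.2 - xstar‖ + ‖xstar - p.1‖ := norm_sub_le_norm_sub_add_norm_sub _ _ _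
      _ ≤ 2 * ρ := by rw [norm_sub_rev xstar]; linarith
  have hxy := (mul_norm_xPoint_sub_le ha0 hL k p.1 p.2).trans
    (mul_le_mul_of_nonneg_left hzy zero_le_two)
  have hgrad := mul_norm_gradient_le_of_bigA_mul_le hf hL hmin ha ((norm_nonneg _).trans hy) hy hfy
  rw [hlevel, le_div_iff₀' (by positivity)]
  set x := xPoint a L k p.1 p.2
  calc ((k : ℝ) + 2) * ‖gradient f x‖
      ≤ (k + 2) * (L * ‖x - p.1‖ + ‖gradient f p.1‖) := by
        gcongr
        exact (norm_le_norm_sub_add (gradient f x) (gradient f p.1)).trans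
          (add_le_add_left (hf.2 x p.1) _)
    _ = L * ((k + 2) * ‖x - p.1‖) + (k + 2) * ‖gradient f p.1‖ := by ring
    _ ≤ L * (2 * (2 * ρ)) + 3 * √a * L * ρ := add_le_add (mul_le_mul_of_nonneg_left hxy hL.le) hgrad
    _ = ρ * (4 + 3 * √a) * L := by ring
    _ ≤ B * a * L := by gcongr

lemma potential_step_safeStates_le (hf : IsLSmooth f L) (hconv : IsStronglyConvex f 0) (hL : 0 < L)
    (ha : 1 ≤ a) {mk : ℕ} (hp : p ∈ safeStates f xstar L a B ρ k) (u : ℕ → S) :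
    potential f xstar (bigA a L (k + 1)) (step a L k p (clippedGradient G L a B mk k p u))
      ≤ potential f xstar (bigA a L k) p + truncError f G xstar L a B ρ mk k (p, u) := by
  have ha0 : 0 < a := by linarith
  rw [truncError, Set.indicator_of_mem hp]
  exact potential_step_le hf.1 hf.2 (fun x y => by simpa using hconv.2 x y)
    (alpha_succ_pos ha0 hL k).le (bigA_nonneg ha0 hL k) (bigA_succ_pos ha0 hL k)
    (mul_sq_alpha_succ_le_bigA ha hL k) xstar rfl

lemma norm_snd_sub_le_of_potential_le {A : ℝ} (hmin : ∀ x, f xstar ≤ f x) (hA : 0 ≤ A)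
    (hρ : 0 ≤ ρ) (h : potential f xstar A p ≤ ρ ^ 2 / 2) : ‖p.2 - xstar‖ ≤ ρ := by
  have hgap := mul_nonneg hA (sub_nonneg.2 (hmin p.1))
  rw [potential] at h
  exact le_of_sq_le_sq (by linarith) hρ

lemma mul_sub_le_of_potential_le {A : ℝ} (h : potential f xstar A p ≤ ρ ^ 2 / 2) :
    A * (f p.1 - f xstar) ≤ ρ ^ 2 / 2 := by
  rw [potential] at h
  linarith [sq_nonneg ‖p.2 - xstar‖]

lemma norm_fst_step_sub_le (ha : 0 < a) (hL : 0 < L) {g : EuclideanSpace ℝ (Fin n)}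
    (hp : ‖p.1 - xstar‖ ≤ ρ) (hz : ‖(step a L k p g).2 - xstar‖ ≤ ρ) :
    ‖(step a L k p g).1 - xstar‖ ≤ ρ := by
  have h := convex_iff_div.1 (convex_closedBall xstar ρ) (mem_closedBall_iff_norm.2 hp)
    (mem_closedBall_iff_norm.2 hz) (bigA_nonneg ha hL k) (alpha_succ_pos ha hL k).le
    (bigA_succ_pos ha hL k)
  rw [div_eq_inv_mul, div_eq_inv_mul, mul_smul, mul_smul, ← smul_add] at h
  exact mem_closedBall_iff_norm.1 h

-- Along the run the truncation is inactive: small error sums keep every state safe.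
lemma potential_iter_le (hf : IsLSmooth f L) (hconv : IsStronglyConvex f 0) (hL : 0 < L)
    (hmin : ∀ x, f xstar ≤ f x) (ha : 1 ≤ a) (hρ : 0 ≤ ρ) (hB : ρ * (4 + 3 * √a) ≤ B * a)
    (hsum : ∀ k ≤ N, ‖x0 - xstar‖ ^ 2 / 2 + errorSum f G xstar L a B ρ m s x0 k ≤ ρ ^ 2 / 2)
    (hk : k ≤ N) :
    potential f xstar (bigA a L k) (iter G L a B m s x0 k)
        ≤ ‖x0 - xstar‖ ^ 2 / 2 + errorSum f G xstar L a B ρ m s x0 k ∧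
      ‖(iter G L a B m s x0 k).1 - xstar‖ ≤ ρ := by
  have ha0 : 0 < a := by linarith
  induction k with
  | zero =>
    have h0 := hsum 0 hk
    simp only [errorSum, Finset.range_zero, Finset.sum_empty, add_zero, iter, potential, bigA,
      zero_mul, zero_add, le_refl, true_and] at h0 ⊢
    exact le_of_sq_le_sq (by linarith) hρ
  | succ k ih =>
    obtain ⟨hpot, hy⟩ := ih (by omega)
    have hpot' := hpot.trans (hsum k (by omega))
    have hsafe : iter G L a B m s x0 k ∈ safeStates f xstar L a B ρ k :=
      mem_safeStates hf hL hmin ha hB hy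
        (norm_snd_sub_le_of_potential_le hmin (bigA_nonneg ha0 hL k) hρ hpot')
        (mul_sub_le_of_potential_le hpot')
    have hstep := potential_step_safeStates_le (G := G) (mk := m k) hf hconv hL ha hsafe (s k)
    rw [← iter_succ] at hstep
    have hnext : potential f xstar (bigA a L (k + 1)) (iter G L a B m s x0 (k + 1))
        ≤ ‖x0 - xstar‖ ^ 2 / 2 + errorSum f G xstar L a B ρ m s x0 (k + 1) := by
      rw [errorSum, Finset.sum_range_succ, ← errorSum]
      linarith
    exact ⟨hnext, norm_fst_step_sub_le ha0 hL hy (norm_snd_sub_le_of_potential_le hmin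
      (bigA_succ_pos ha0 hL k).le hρ (hnext.trans (hsum (k + 1) hk)))⟩

lemma gap_iter_le (hf : IsLSmooth f L) (hconv : IsStronglyConvex f 0) (hL : 0 < L) (hμ : 0 < μ)
    (hgrowth : ∀ x, μ / 2 * ‖x - xstar‖ ^ 2 ≤ f x - f xstar) (ha : 1 ≤ a) (hρ : 0 ≤ ρ)
    (hB : ρ * (4 + 3 * √a) ≤ B * a) (hx0 : f x0 - f xstar ≤ μ * ρ ^ 2 / 10)
    (hN : 40 * a * L / μ ≤ (N : ℝ) ^ 2)
    (hsum : ∀ k ≤ N, errorSum f G xstar L a B ρ m s x0 k ≤ 2 / 5 * ρ ^ 2) :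
    f (iter G L a B m s x0 N).1 - f xstar ≤ μ * ρ ^ 2 / 20 := by
  have ha0 : 0 < a := by linarith
  have hmin : ∀ x, f xstar ≤ f x := fun x =>
    sub_nonneg.1 ((by positivity : 0 ≤ μ / 2 * ‖x - xstar‖ ^ 2).trans (hgrowth x))
  have hdist : ‖x0 - xstar‖ ^ 2 / 2 ≤ ρ ^ 2 / 10 :=
    le_of_mul_le_mul_left (by linarith [hgrowth x0]) hμ
  have hsum' : ∀ k ≤ N,
      ‖x0 - xstar‖ ^ 2 / 2 + errorSum f G xstar L a B ρ m s x0 k ≤ ρ ^ 2 / 2 :=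
    fun k hk => by linarith [hsum k hk]
  have hpot := (potential_iter_le hf hconv hL hmin ha hρ hB hsum' le_rfl).1.trans
    (hsum' N le_rfl)
  have hgap := mul_sub_le_of_potential_le hpot
  set y := (iter G L a B m s x0 N).1
  have hy : 0 ≤ f y - f xstar := sub_nonneg.2 (hmin y)
  have hNpos : 0 < (N : ℝ) ^ 2 := lt_of_lt_of_le (by positivity) hN
  rw [bigA_eq, div_mul_eq_mul_div, div_le_iff₀ (by positivity)] at hgap
  rw [div_le_iff₀ hμ] at hN
  refine le_of_mul_le_mul_left ?_ hNpos
  calc (N : ℝ) ^ 2 * (f y - f xstar) ≤ N * (N + 3) * (f y - f xstar) := by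
        gcongr; nlinarith [N.cast_nonneg (α := ℝ)]
    _ ≤ ρ ^ 2 / 2 * (4 * a * L) := hgap
    _ = ρ ^ 2 / 20 * (40 * a * L) := by ring
    _ ≤ ρ ^ 2 / 20 * ((N : ℝ) ^ 2 * μ) := by gcongr
    _ = (N : ℝ) ^ 2 * (μ * ρ ^ 2 / 20) := by ring

lemma eight_mul_le_of_le_stepsize {ℓ : ℝ} (hℓ : 0 ≤ ℓ)
    (ha : 36 * (2 * ℓ + √(4 * ℓ ^ 2 + 2 * ℓ)) ^ 2 ≤ a) : 8 * ℓ * (4 + 3 * √a) ≤ a := by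
  have hdisc : √(4 * ℓ ^ 2 + 2 * ℓ) ^ 2 = 4 * ℓ ^ 2 + 2 * ℓ := Real.sq_sqrt (by positivity)
  set r := √(4 * ℓ ^ 2 + 2 * ℓ)
  have : 0 ≤ r := Real.sqrt_nonneg _
  have hroot : 6 * (2 * ℓ + r) ≤ √a := Real.le_sqrt_of_sq_le (by rw [mul_pow]; linarith)
  -- `6 (2 ℓ + r)` is the larger root of `q ^ 2 - 24 ℓ q - 72 ℓ`.
  have hsq : (6 * r) ^ 2 ≤ (√a - 12 * ℓ) ^ 2 := by gcongr; linarith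
  have ha0 : 0 ≤ a := le_trans (by positivity) ha
  nlinarith [Real.sq_sqrt ha0]

end Run

/-! ### Concentration along a run -/

section Measurability

variable {n : ℕ} {S : Type*} [MeasurableSpace S] {f : EuclideanSpace ℝ (Fin n) → ℝ}
  {G : EuclideanSpace ℝ (Fin n) → S → EuclideanSpace ℝ (Fin n)}

lemma measurable_clip (l : ℝ) : Measurable fun g : EuclideanSpace ℝ (Fin n) => clip g l := by
  unfold clip
  fun_prop

lemma measurable_miniBatch (hG : Measurable (Function.uncurry G)) (m : ℕ) :
    Measurable fun q : EuclideanSpace ℝ (Fin n) × (ℕ → S) => miniBatch G m q.2 q.1 := by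
  have hsum : Measurable fun q : EuclideanSpace ℝ (Fin n) × (ℕ → S) =>
      ∑ i ∈ Finset.range m, G q.1 (q.2 i) :=
    Finset.measurable_fun_sum _ fun i _ =>
      hG.comp (measurable_fst.prodMk ((measurable_pi_apply i).comp measurable_snd))
  exact hsum.const_smul (m : ℝ)⁻¹

lemma measurable_xPoint (a L : ℝ) (k : ℕ) :
    Measurable fun p : EuclideanSpace ℝ (Fin n) × EuclideanSpace ℝ (Fin n) =>
      xPoint a L k p.1 p.2 := by
  unfold xPoint
  fun_prop

lemma measurable_clippedGradient {α : Type*} {_ : MeasurableSpace α}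
    (hG : Measurable (Function.uncurry G)) (L a B : ℝ) (m k : ℕ)
    {p : α → EuclideanSpace ℝ (Fin n) × EuclideanSpace ℝ (Fin n)} {u : α → ℕ → S}
    (hp : Measurable p) (hu : Measurable u) :
    Measurable fun ω => clippedGradient G L a B m k (p ω) (u ω) := by
  have hx : Measurable fun ω => xPoint a L k (p ω).1 (p ω).2 := (measurable_xPoint a L k).comp hp
  have hg : Measurable fun ω => miniBatch G m (u ω) (xPoint a L k (p ω).1 (p ω).2) :=
    (measurable_miniBatch hG m).comp (hx.prodMk hu)
  exact (measurable_clip (B / alpha a L (k + 1))).comp hg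

lemma measurable_step {α : Type*} {_ : MeasurableSpace α} (a L : ℝ) (k : ℕ)
    {p : α → EuclideanSpace ℝ (Fin n) × EuclideanSpace ℝ (Fin n)}
    {g : α → EuclideanSpace ℝ (Fin n)} (hp : Measurable p) (hg : Measurable g) :
    Measurable fun ω => step a L k (p ω) (g ω) := by
  unfold step
  fun_prop

lemma measurableSet_safeStates (hf : Measurable (gradient f)) (xstar : EuclideanSpace ℝ (Fin n))
    (L a B ρ : ℝ) (k : ℕ) : MeasurableSet (safeStates f xstar L a B ρ k) :=
  (measurableSet_le (measurable_snd.sub_const xstar).norm measurable_const).inter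
    (measurableSet_le (hf.comp (measurable_xPoint a L k)).norm measurable_const)

lemma measurable_truncError (hf : Measurable (gradient f)) (hG : Measurable (Function.uncurry G))
    (xstar : EuclideanSpace ℝ (Fin n)) (L a B ρ : ℝ) (m k : ℕ) :
    Measurable (truncError f G xstar L a B ρ m k) := by
  have hv : Measurable fun q : (EuclideanSpace ℝ (Fin n) × EuclideanSpace ℝ (Fin n)) × (ℕ → S) =>
      gradient f (xPoint a L k q.1.1 q.1.2) :=
    hf.comp ((measurable_xPoint a L k).comp measurable_fst)
  have hθ := (measurable_clippedGradient hG L a B m k measurable_fst measurable_snd).sub hv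
  have hdir := (((measurable_fst.snd.const_sub xstar).const_smul (alpha a L (k + 1))).add
    (hv.const_smul (alpha a L (k + 1) ^ 2)))
  exact ((hθ.inner hdir).add ((hθ.norm.pow_const 2).const_mul _)).indicator
    (measurable_fst (measurableSet_safeStates hf xstar L a B ρ k))

end Measurability

section Sampling

variable {S Ω : Type*} [MeasurableSpace S] {mΩ : MeasurableSpace Ω} {ξ : ℕ → ℕ → ℕ → Ω → S}

/-- The filtration of run `t`: its `k`-th `σ`-algebra is generated by all samples used before
iteration `k` of run `t`, those of the earlier runs included. -/
def past (hξ : ∀ t k i, Measurable (ξ t k i)) (t : ℕ) : Filtration ℕ mΩ where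
  seq k := ⨆ j ∈ {j : ℕ × ℕ × ℕ | j.1 < t ∨ j.1 = t ∧ j.2.1 < k},
    MeasurableSpace.comap (ξ j.1 j.2.1 j.2.2) inferInstance
  mono' _ _ hk := biSup_mono fun _ hj => hj.imp_right fun h => ⟨h.1, h.2.trans_le hk⟩
  le' _ := iSup₂_le fun _ _ => (hξ _ _ _).comap_le

lemma past_le_past_succ (hξ : ∀ t k i, Measurable (ξ t k i)) (t k : ℕ) :
    past hξ t k ≤ past hξ (t + 1) 0 :=
  biSup_mono fun j (hj : _ ∨ _) => show _ ∨ _ by omega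

lemma measurable_samples_of_mem {J : Set (ℕ × ℕ × ℕ)} {t k : ℕ} (hJ : ∀ i, (t, k, i) ∈ J) :
    Measurable[⨆ j ∈ J, MeasurableSpace.comap (ξ j.1 j.2.1 j.2.2) inferInstance]
      fun ω i => ξ t k i ω :=
  @measurable_pi_lambda _ _ _ (_) _ _ fun i => (comap_measurable (ξ t k i)).mono
    (le_iSup₂_of_le (f := fun (j : ℕ × ℕ × ℕ) (_ : j ∈ J) =>
      MeasurableSpace.comap (ξ j.1 j.2.1 j.2.2) inferInstance) (t, k, i) (hJ i) le_rfl) le_rfl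

lemma measurable_samples_past (hξ : ∀ t k i, Measurable (ξ t k i)) (t k : ℕ) :
    Measurable[past hξ t (k + 1)] fun ω i => ξ t k i ω :=
  measurable_samples_of_mem fun _ => Or.inr ⟨rfl, Nat.lt_succ_self k⟩

lemma indep_past_samples {P : Measure Ω} (hξ : ∀ t k i, Measurable (ξ t k i))
    (hindep : iIndepFun (fun j : ℕ × ℕ × ℕ => ξ j.1 j.2.1 j.2.2) P) (t k : ℕ) :
    Indep (past hξ t k) (MeasurableSpace.comap (fun ω i => ξ t k i ω) inferInstance) P := by
  have hdisj : Disjoint {j : ℕ × ℕ × ℕ | j.1 < t ∨ j.1 = t ∧ j.2.1 < k}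
      {j | j.1 = t ∧ j.2.1 = k} := by
    rw [Set.disjoint_left]
    rintro j (hj : _ ∨ _) (hj' : _ ∧ _)
    omega
  exact indep_of_indep_of_le_right
    (indep_iSup_of_disjoint (fun j : ℕ × ℕ × ℕ => (hξ j.1 j.2.1 j.2.2).comap_le) hindep hdisj)
    (measurable_samples_of_mem (J := {j | j.1 = t ∧ j.2.1 = k}) fun _ => ⟨rfl, rfl⟩).comap_le

variable {n : ℕ} {G : EuclideanSpace ℝ (Fin n) → S → EuclideanSpace ℝ (Fin n)}

lemma measurable_iter_past (hG : Measurable (Function.uncurry G))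
    (hξ : ∀ t k i, Measurable (ξ t k i)) (L a B : ℝ) (m : ℕ → ℕ) {t : ℕ}
    {X : Ω → EuclideanSpace ℝ (Fin n)} (hX : Measurable[past hξ t 0] X) (k : ℕ) :
    Measurable[past hξ t k] fun ω => iter G L a B m (fun k i => ξ t k i ω) (X ω) k := by
  induction k with
  | zero => exact hX.prodMk hX
  | succ k ih =>
    have hp := ih.mono ((past hξ t).mono k.le_succ) le_rfl
    simp only [iter_succ]
    exact measurable_step a L k hp (measurable_clippedGradient hG L a B (m k) k hp
      (measurable_samples_past hξ t k))

lemma measurable_restarted_past (hG : Measurable (Function.uncurry G))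
    (hξ : ∀ t k i, Measurable (ξ t k i)) (L a : ℝ) (N₀ : ℕ) (B : ℕ → ℝ) (m : ℕ → ℕ → ℕ)
    (x0 : EuclideanSpace ℝ (Fin n)) (t : ℕ) :
    Measurable[past hξ t 0] fun ω => restarted G L a N₀ B m (fun t k i => ξ t k i ω) x0 t := by
  induction t with
  | zero => exact @measurable_const _ _ _ (_) _
  | succ t ih =>
    exact (measurable_fst.comp (measurable_iter_past hG hξ L a (B t) (m t) ih N₀)).mono
      (past_le_past_succ hξ t N₀) le_rfl

end Sampling

section Concentration

variable {n : ℕ} {S Ω : Type*} [MeasurableSpace S] [MeasurableSpace Ω] {P : Measure Ω}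
  [IsProbabilityMeasure P] {D : Measure S} {f : EuclideanSpace ℝ (Fin n) → ℝ}
  {G : EuclideanSpace ℝ (Fin n) → S → EuclideanSpace ℝ (Fin n)} {σ L a ρ ℓ : ℝ} {N : ℕ}

lemma lintegral_exp_truncError_le (hG : IsStochasticGradient f G D σ) {u : ℕ → Ω → S}
    (hu : ∀ i, MeasurePreserving (u i) P D) (hindep : iIndepFun u P)
    (xstar : EuclideanSpace ℝ (Fin n)) (hL : 0 < L) (ha : 0 < a) (hρ : 0 < ρ) (hℓ : 2 ≤ ℓ)
    (hN : 0 < N) {m k : ℕ} (hm : m ≠ 0)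
    (hmσ : 6000 * σ ^ 2 * alpha a L (k + 1) ^ 2 * N * ℓ / ρ ^ 2 ≤ m)
    (p : EuclideanSpace ℝ (Fin n) × EuclideanSpace ℝ (Fin n)) :
    ∫⁻ ω, ENNReal.ofReal (Real.exp (4 * ℓ / ρ ^ 2 *
        truncError f G xstar L a (ρ / (8 * ℓ)) ρ m k (p, fun i => u i ω))) ∂P
      ≤ ENNReal.ofReal (Real.exp (ℓ / (150 * N))) := by
  by_cases hp : p ∈ safeStates f xstar L a (ρ / (8 * ℓ)) ρ k
  · simp only [truncError, Set.indicator_of_mem hp]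
    have hexp := fun ω => exp_stepError_clip_le
      (g := miniBatch G m (fun i => u i ω) (xPoint a L k p.1 p.2))
      (alpha_succ_pos ha hL k) hρ hℓ rfl hp.1 hp.2
    refine (lintegral_exp_le_of_le_one_add_inner (hG.memLp_miniBatch_sub hu hm _)
      (hG.integral_miniBatch_sub_eq_zero hu hm _)
      (hG.integral_sq_norm_miniBatch_sub_le hu hindep hm _) (by positivity) hexp).trans ?_
    have hm0 : (0 : ℝ) < m := by exact_mod_cast Nat.pos_of_ne_zero hm
    have : (0 : ℝ) < N := by exact_mod_cast hN
    gcongr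
    calc 40 * ℓ ^ 2 * alpha a L (k + 1) ^ 2 / ρ ^ 2 * (σ ^ 2 / m)
        = ℓ / (150 * N) * (6000 * σ ^ 2 * alpha a L (k + 1) ^ 2 * N * ℓ / ρ ^ 2) / m := by
          field_simp
          ring
      _ ≤ ℓ / (150 * N) * m / m := by gcongr
      _ = ℓ / (150 * N) := mul_div_cancel_right₀ _ hm0.ne'
  · simp only [truncError, Set.indicator_of_notMem hp, mul_zero, Real.exp_zero, lintegral_const,
      measure_univ, mul_one]
    gcongr
    exact Real.one_le_exp (by positivity)

lemma measureReal_exists_lt_errorSum_le (hG : IsStochasticGradient f G D σ)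
    (hf : Measurable (gradient f)) {ξ : ℕ → ℕ → ℕ → Ω → S} (hξ : ∀ t k i, Measurable (ξ t k i))
    (hD : ∀ t k i, P.map (ξ t k i) = D)
    (hindep : iIndepFun (fun j : ℕ × ℕ × ℕ => ξ j.1 j.2.1 j.2.2) P)
    (xstar : EuclideanSpace ℝ (Fin n)) (hL : 0 < L) (ha : 0 < a) (hρ : 0 < ρ) (hℓ : 2 ≤ ℓ)
    (hN : 0 < N) {m : ℕ → ℕ} (hm : ∀ k, m k ≠ 0)
    (hmσ : ∀ k, 6000 * σ ^ 2 * alpha a L (k + 1) ^ 2 * N * ℓ / ρ ^ 2 ≤ m k) {t : ℕ}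
    {X : Ω → EuclideanSpace ℝ (Fin n)} (hX : Measurable[past hξ t 0] X) :
    P.real {ω | ∃ k ≤ N, 2 / 5 * ρ ^ 2 <
        errorSum f G xstar L a (ρ / (8 * ℓ)) ρ m (fun k i => ξ t k i ω) (X ω) k}
      ≤ N * Real.exp (-ℓ) := by
  have hmoment := fun k => lintegral_exp_truncError_le hG (fun i => ⟨hξ t k i, hD t k i⟩)
    (hindep.precomp (g := fun i => (t, k, i)) fun i j h => by simpa using h) xstar hL ha hρ hℓ hN
    (hm k) (hmσ k)
  have hchernoff := measureReal_exists_lt_sum_le (r := 8 / 5 * ℓ)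
    (measurable_iter_past hG.measurable hξ L a (ρ / (8 * ℓ)) m hX)
    (measurable_samples_past hξ t) (indep_past_samples hξ hindep t)
    (fun k => (measurable_truncError hf hG.measurable xstar L a _ ρ (m k) k).const_mul
      (4 * ℓ / ρ ^ 2)) hmoment (by positivity) (by positivity) N
  simp only [← Finset.mul_sum] at hchernoff
  have : (0 : ℝ) < N := by exact_mod_cast hN
  have hscale : ∀ x : ℝ, 2 / 5 * ρ ^ 2 < x ↔ 8 / 5 * ℓ < 4 * ℓ / ρ ^ 2 * x := fun x => by
    rw [show 8 / 5 * ℓ = 4 * ℓ / ρ ^ 2 * (2 / 5 * ρ ^ 2) by field_simp; norm_num]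
    exact (mul_lt_mul_iff_right₀ (by positivity)).symm
  simp only [errorSum, hscale]
  refine hchernoff.trans ?_
  gcongr
  rw [show N * (ℓ / (150 * N)) = ℓ / 150 by field_simp]
  linarith

end Concentration

/-! ### Restarts -/

section Parameters

lemma constC_pos : 0 < constC := Real.sqrt_pos.2 (by norm_num)

lemma sq_constC : constC ^ 2 = 5 := Real.sq_sqrt (by norm_num)

lemma pos_of_logFactor_pos {N₀ τ : ℕ} {β : ℝ} (h : 0 < logFactor N₀ τ β) : 0 < N₀ ∧ 0 < τ := by
  constructor <;>
  · rw [Nat.pos_iff_ne_zero]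
    rintro rfl
    simp [logFactor] at h

lemma mul_exp_neg_logFactor {N₀ τ : ℕ} {β : ℝ} (hN : 0 < N₀) (hτ : 0 < τ) (hβ : 0 < β) :
    N₀ * Real.exp (-logFactor N₀ τ β) = β / (4 * τ) := by
  rw [Real.exp_neg, logFactor, Real.exp_log (by positivity)]
  field_simp

lemma batchSize_ne_zero (L σ β R a : ℝ) (N₀ τ t k : ℕ) : batchSize L σ β R a N₀ τ t k ≠ 0 :=
  (Nat.ceil_pos.2 (one_pos.trans_le (le_max_left _ _))).ne'

lemma le_batchSize (L σ β R a : ℝ) (N₀ τ t k : ℕ) :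
    6000 * 2 ^ t * σ ^ 2 * alpha a L (k + 1) ^ 2 * N₀ * logFactor N₀ τ β / (constC ^ 2 * R ^ 2)
      ≤ batchSize L σ β R a N₀ τ t k :=
  ((le_max_left _ _).trans (le_max_right _ _)).trans (Nat.le_ceil _)

/-- The radius `√5 R / 2 ^ (t / 2)` of the ball around the minimizer to which the auxiliary iterates
`z^k` of run `t` are confined with high probability. -/
noncomputable def runRadius (R : ℝ) (t : ℕ) : ℝ := constC * R / (2 : ℝ) ^ ((t : ℝ) / 2)

lemma sq_runRadius (R : ℝ) (t : ℕ) : runRadius R t ^ 2 = 5 * R ^ 2 / 2 ^ t := by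
  have hpow : ((2 : ℝ) ^ ((t : ℝ) / 2)) ^ 2 = 2 ^ t := by
    rw [← Real.rpow_mul_natCast zero_le_two, Nat.cast_two, div_mul_cancel₀ _ two_ne_zero,
      Real.rpow_natCast]
  rw [runRadius, div_pow, mul_pow, hpow, sq_constC]

lemma runRadius_pos {R : ℝ} (hR : 0 < R) (t : ℕ) : 0 < runRadius R t :=
  div_pos (mul_pos constC_pos hR) (Real.rpow_pos_of_pos two_pos _)

lemma clipParam_eq (β R : ℝ) (N₀ τ t : ℕ) :
    clipParam β R N₀ τ t = runRadius R t / (8 * logFactor N₀ τ β) := by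
  rw [clipParam, runRadius, div_div]
  congr 1
  ring

lemma runRadius_mul_le_clipParam_mul {β R a : ℝ} {N₀ τ : ℕ} (hR : 0 < R)
    (hℓ : 0 < logFactor N₀ τ β) (ha : aLowerBound β N₀ τ ≤ a) (t : ℕ) :
    runRadius R t * (4 + 3 * √a) ≤ clipParam β R N₀ τ t * a := by
  have hρ := runRadius_pos hR t
  have h := eight_mul_le_of_le_stepsize hℓ.le
    (((le_max_right _ _).trans (le_max_right _ _)).trans ha)
  rw [clipParam_eq, div_mul_eq_mul_div, le_div_iff₀ (by positivity)]
  calc runRadius R t * (4 + 3 * √a) * (8 * logFactor N₀ τ β)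
      = runRadius R t * (8 * logFactor N₀ τ β * (4 + 3 * √a)) := by ring
    _ ≤ runRadius R t * a := by gcongr

end Parameters

section Restarts

variable {n : ℕ} {S : Type*} {f : EuclideanSpace ℝ (Fin n) → ℝ}
  {G : EuclideanSpace ℝ (Fin n) → S → EuclideanSpace ℝ (Fin n)}
  {x0 xstar : EuclideanSpace ℝ (Fin n)} {L μ σ β R a : ℝ} {N₀ τ : ℕ}

lemma gap_restarted_le (hf : IsLSmooth f L) (hconv : IsStronglyConvex f 0) (hL : 0 < L)
    (hμ : 0 < μ) (hgrowth : ∀ x, μ / 2 * ‖x - xstar‖ ^ 2 ≤ f x - f xstar) (ha : 1 ≤ a)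
    (hR : 0 < R) (hx0 : f x0 - f xstar ≤ μ * R ^ 2 / 2) (hN : 40 * a * L / μ ≤ (N₀ : ℝ) ^ 2)
    {B : ℕ → ℝ} {m : ℕ → ℕ → ℕ} {s : ℕ → ℕ → ℕ → S}
    (hB : ∀ t < τ, runRadius R t * (4 + 3 * √a) ≤ B t * a)
    (hsum : ∀ t < τ, ∀ k ≤ N₀, errorSum f G xstar L a (B t) (runRadius R t) (m t) (s t)
      (restarted G L a N₀ B m s x0 t) k ≤ 2 / 5 * runRadius R t ^ 2) :
    f (restarted G L a N₀ B m s x0 τ) - f xstar ≤ μ * R ^ 2 / (2 * 2 ^ τ) := by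
  induction τ with
  | zero => simpa only [restarted, pow_zero, mul_one] using hx0
  | succ t ih =>
    have hstart : f (restarted G L a N₀ B m s x0 t) - f xstar ≤ μ * runRadius R t ^ 2 / 10 := by
      refine (ih (fun i hi => hB i (hi.trans t.lt_succ_self))
        fun i hi => hsum i (hi.trans t.lt_succ_self)).trans_eq ?_
      rw [sq_runRadius]
      field_simp
      norm_num
    refine (gap_iter_le hf hconv hL hμ hgrowth ha (runRadius_pos hR t).le (hB t t.lt_succ_self)
      hstart hN (hsum t t.lt_succ_self)).trans_eq ?_
    rw [sq_runRadius]
    field_simp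
    ring

/-- The event that some truncated error sum of run `t` of R-clipped-SSTM is too large for that run
to halve the gap. -/
def largeErrorEvent {Ω : Type*} (f : EuclideanSpace ℝ (Fin n) → ℝ)
    (G : EuclideanSpace ℝ (Fin n) → S → EuclideanSpace ℝ (Fin n)) (ξ : ℕ → ℕ → ℕ → Ω → S)
    (x0 xstar : EuclideanSpace ℝ (Fin n)) (L σ β R a : ℝ) (N₀ τ t : ℕ) : Set Ω :=
  {ω | ∃ k ≤ N₀, 2 / 5 * runRadius R t ^ 2 <
    errorSum f G xstar L a (clipParam β R N₀ τ t) (runRadius R t) (batchSize L σ β R a N₀ τ t)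
      (fun k i => ξ t k i ω) (restarted G L a N₀ (clipParam β R N₀ τ) (batchSize L σ β R a N₀ τ)
        (fun t k i => ξ t k i ω) x0 t) k}

variable {Ω : Type*} [MeasurableSpace S] [MeasurableSpace Ω] {P : Measure Ω}
  [IsProbabilityMeasure P] {D : Measure S} {ξ : ℕ → ℕ → ℕ → Ω → S}

lemma measureReal_largeErrorEvent_le (hG : IsStochasticGradient f G D σ)
    (hf : Measurable (gradient f)) (hξ : ∀ t k i, Measurable (ξ t k i))
    (hD : ∀ t k i, P.map (ξ t k i) = D)
    (hindep : iIndepFun (fun j : ℕ × ℕ × ℕ => ξ j.1 j.2.1 j.2.2) P)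
    (x0 xstar : EuclideanSpace ℝ (Fin n)) (hL : 0 < L) (ha : 0 < a) (hβ : 0 < β) (hR : 0 < R)
    (hℓ : 2 ≤ logFactor N₀ τ β) (t : ℕ) :
    P.real (largeErrorEvent f G ξ x0 xstar L σ β R a N₀ τ t) ≤ β / (4 * τ) := by
  obtain ⟨hN, hτ⟩ := pos_of_logFactor_pos (two_pos.trans_le hℓ)
  rw [← mul_exp_neg_logFactor hN hτ hβ]
  unfold largeErrorEvent
  rw [clipParam_eq]
  refine measureReal_exists_lt_errorSum_le hG hf hξ hD hindep xstar hL ha (runRadius_pos hR t) hℓ hN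
    (fun k => batchSize_ne_zero L σ β R a N₀ τ t k) (fun k => ?_)
    (measurable_restarted_past hG.measurable hξ L a N₀ (clipParam β R N₀ τ)
      (batchSize L σ β R a N₀ τ) x0 t)
  refine Eq.trans_le ?_ (le_batchSize L σ β R a N₀ τ t k)
  rw [sq_runRadius, sq_constC]
  field_simp

lemma measureReal_biUnion_largeErrorEvent_le (hG : IsStochasticGradient f G D σ)
    (hf : Measurable (gradient f)) (hξ : ∀ t k i, Measurable (ξ t k i))
    (hD : ∀ t k i, P.map (ξ t k i) = D)
    (hindep : iIndepFun (fun j : ℕ × ℕ × ℕ => ξ j.1 j.2.1 j.2.2) P)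
    (x0 xstar : EuclideanSpace ℝ (Fin n)) (hL : 0 < L) (ha : 0 < a) (hβ : 0 < β) (hR : 0 < R)
    (hℓ : 2 ≤ logFactor N₀ τ β) :
    P.real (⋃ t ∈ Finset.range τ, largeErrorEvent f G ξ x0 xstar L σ β R a N₀ τ t) ≤ β := by
  have hτ : (0 : ℝ) < τ := by exact_mod_cast (pos_of_logFactor_pos (two_pos.trans_le hℓ)).2
  calc P.real (⋃ t ∈ Finset.range τ, largeErrorEvent f G ξ x0 xstar L σ β R a N₀ τ t)
      ≤ ∑ t ∈ Finset.range τ, P.real (largeErrorEvent f G ξ x0 xstar L σ β R a N₀ τ t) :=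
        measureReal_biUnion_finset_le _ _
    _ ≤ ∑ _t ∈ Finset.range τ, β / (4 * τ) := Finset.sum_le_sum fun t _ =>
        measureReal_largeErrorEvent_le hG hf hξ hD hindep x0 xstar hL ha hβ hR hℓ t
    _ = β / 4 := by
        rw [Finset.sum_const, Finset.card_range, nsmul_eq_mul]
        field_simp
    _ ≤ β := by linarith

lemma one_sub_le_measureReal_gap_restarted_le (hf : IsLSmooth f L) (hconv : IsStronglyConvex f 0)
    (hL : 0 < L) (hμ : 0 < μ) (hgrowth : ∀ x, μ / 2 * ‖x - xstar‖ ^ 2 ≤ f x - f xstar)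
    (hG : IsStochasticGradient f G D σ) (hξ : ∀ t k i, Measurable (ξ t k i))
    (hD : ∀ t k i, P.map (ξ t k i) = D)
    (hindep : iIndepFun (fun j : ℕ × ℕ × ℕ => ξ j.1 j.2.1 j.2.2) P) (hβ : 0 < β) (hR : 0 < R)
    (hx0 : f x0 - f xstar ≤ μ * R ^ 2 / 2) (hℓ : 2 ≤ logFactor N₀ τ β)
    (hN : 40 * a * L / μ ≤ (N₀ : ℝ) ^ 2) (ha : aLowerBound β N₀ τ ≤ a) :
    1 - β ≤ P.real {ω | f (restarted G L a N₀ (clipParam β R N₀ τ) (batchSize L σ β R a N₀ τ)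
      (fun t k i => ξ t k i ω) x0 τ) - f xstar ≤ μ * R ^ 2 / (2 * 2 ^ τ)} := by
  have ha1 : 1 ≤ a := (le_max_left _ _).trans ha
  have hbad := measureReal_biUnion_largeErrorEvent_le hG (hf.continuous_gradient).measurable hξ hD
    hindep x0 xstar hL (one_pos.trans_le ha1) hβ hR hℓ
  set bad := ⋃ t ∈ Finset.range τ, largeErrorEvent f G ξ x0 xstar L σ β R a N₀ τ t with hbad_def
  set good := {ω | f (restarted G L a N₀ (clipParam β R N₀ τ) (batchSize L σ β R a N₀ τ)
    (fun t k i => ξ t k i ω) x0 τ) - f xstar ≤ μ * R ^ 2 / (2 * 2 ^ τ)}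
  have hgood : badᶜ ⊆ good := fun ω hω => by
    simp only [hbad_def, Set.compl_iUnion, Set.mem_iInter, Finset.mem_range] at hω
    refine gap_restarted_le hf hconv hL hμ hgrowth ha1 hR hx0 hN
      (fun t _ => runRadius_mul_le_clipParam_mul hR (two_pos.trans_le hℓ) ha t)
      fun t ht k hk => ?_
    by_contra! hlt
    exact hω t ht ⟨k, hk, hlt⟩
  have hcover : Set.univ ⊆ good ∪ bad := fun ω _ => or_iff_not_imp_right.2 fun h => hgood h
  have hunion := (measureReal_mono hcover).trans (measureReal_union_le (μ := P) good bad)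
  rw [probReal_univ] at hunion
  linarith

end Restarts

/-! ### Complexity -/

section Complexity

lemma one_lt_of_ceil_logb_pos {x : ℝ} (hx : 0 ≤ x) (h : 0 < ⌈Real.logb 2 x⌉₊) : 1 < x := by
  by_contra! hx1
  exact (Nat.ceil_pos.1 h).not_ge (Real.logb_nonpos one_lt_two hx hx1)

lemma le_two_pow_ceil_logb {x : ℝ} (hx : 0 < x) : x ≤ 2 ^ ⌈Real.logb 2 x⌉₊ := by
  rw [← Real.rpow_natCast, ← Real.logb_le_iff_le_rpow one_lt_two hx]
  exact Nat.le_ceil _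

lemma two_pow_lt_of_lt_ceil_logb {x : ℝ} (hx : 0 < x) {t : ℕ} (ht : t < ⌈Real.logb 2 x⌉₊) :
    (2 : ℝ) ^ t < x := by
  rwa [Nat.lt_ceil, Real.lt_logb_iff_rpow_lt one_lt_two hx, Real.rpow_natCast] at ht

lemma ceil_logb_mul_log_le {x : ℝ} (hx : 1 < x) :
    ⌈Real.logb 2 x⌉₊ * Real.log 2 ≤ Real.log (2 * x) := by
  have : 0 < Real.log 2 := Real.log_pos one_lt_two
  calc ⌈Real.logb 2 x⌉₊ * Real.log 2 ≤ (Real.logb 2 x + 1) * Real.log 2 := by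
        gcongr
        exact (Nat.ceil_lt_add_one (Real.logb_pos one_lt_two hx).le).le
    _ = Real.log 2 + Real.log x := by
        rw [Real.logb]
        field_simp
        ring
    _ = Real.log (2 * x) := (Real.log_mul two_ne_zero (one_pos.trans hx).ne').symm

lemma le_two_mul_log_of_exp_le {x q : ℝ} (hx : 0 < x) (hq : 0 < q) (h : Real.exp x ≤ q * x) :
    x ≤ 2 * Real.log q := by
  have hhalf : x ≤ Real.exp (x / 2) := by
    have := Real.quadratic_le_exp_of_nonneg (x := x / 2) (by positivity)
    nlinarith [sq_nonneg (x / 2 - 1)]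
  have hexp : Real.exp (x / 2) ≤ q := by
    refine le_of_mul_le_mul_right ?_ (Real.exp_pos (x / 2))
    rw [← Real.exp_add, add_halves]
    exact h.trans (by gcongr)
  linarith [(Real.le_log_iff_exp_le hq).2 hexp]

lemma le_of_le_mul_log {T Y β c : ℝ} (hT : 0 < T) (hY : 0 < Y) (hβ : 0 < β) (hc : 0 < c)
    (hlog : 0 < Real.log (T / β)) (h : T ≤ c * Y * Real.log (T / β)) :
    T ≤ c * (2 * |Real.log c| + 2) * (Y * max 1 (Real.log (Y / β))) := by
  set Λ := Real.log (T / β) with hΛ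
  set M := max 1 (Real.log (Y / β))
  have hexp : Real.exp Λ ≤ c * (Y / β) * Λ := by
    rw [hΛ, Real.exp_log (by positivity), ← hΛ, div_le_iff₀ hβ]
    refine h.trans_eq ?_
    field_simp
  have hself := le_two_mul_log_of_exp_le hlog (by positivity) hexp
  rw [Real.log_mul hc.ne' (by positivity)] at hself
  have hΛM : Λ ≤ (2 * |Real.log c| + 2) * M := by
    have hM : Real.log (Y / β) ≤ M := le_max_right _ _
    have habs : |Real.log c| ≤ |Real.log c| * M :=
      le_mul_of_one_le_right (abs_nonneg _) (le_max_left _ _)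
    linarith [le_abs_self (Real.log c)]
  calc T ≤ c * Y * Λ := h
    _ ≤ c * Y * ((2 * |Real.log c| + 2) * M) := by gcongr
    _ = c * (2 * |Real.log c| + 2) * (Y * M) := by ring

lemma logFactor_eq {N₀ τ : ℕ} {β : ℝ} (hN : 0 < N₀) (hτ : 0 < τ) (hβ : 0 < β) :
    logFactor N₀ τ β = Real.log 4 + Real.log (N₀ * τ / β) := by
  rw [logFactor, ← Real.log_mul four_ne_zero (by positivity)]
  congr 1
  ring

lemma logFactor_le_four_mul_log {N₀ τ : ℕ} {β : ℝ} (hβ : 0 < β) (hℓ : 2 ≤ logFactor N₀ τ β) :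
    logFactor N₀ τ β ≤ 4 * Real.log (N₀ * τ / β) := by
  obtain ⟨hN, hτ⟩ := pos_of_logFactor_pos (two_pos.trans_le hℓ)
  have hlog4 : Real.log 4 = 2 * Real.log 2 := by
    rw [show (4 : ℝ) = 2 ^ 2 by norm_num, Real.log_pow, Nat.cast_two]
  have hsum := logFactor_eq hN hτ hβ
  linarith [Real.log_two_lt_d9]

variable {L μ σ ε β R a c₁ c₂ c₄ Λ : ℝ} {N₀ τ t k : ℕ}

lemma sqrt_stepsize_le (hL : 0 < L) (hμ : 0 < μ) (hε : 0 < ε) (hc₂ : 0 ≤ c₂) (hΛ : 0 ≤ Λ)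
    (ha : a ≤ c₂ * (σ ^ 4 * Λ ^ 2 / (L * μ * ε ^ 2))) :
    √(a * L / μ) ≤ √c₂ * (σ ^ 2 / (μ * ε) * Λ) := by
  refine Real.sqrt_le_iff.2 ⟨by positivity, ?_⟩
  calc a * L / μ ≤ c₂ * (σ ^ 4 * Λ ^ 2 / (L * μ * ε ^ 2)) * L / μ := by gcongr
    _ = c₂ * (σ ^ 2 / (μ * ε) * Λ) ^ 2 := by field_simp
    _ = (√c₂ * (σ ^ 2 / (μ * ε) * Λ)) ^ 2 := by rw [mul_pow √c₂, Real.sq_sqrt hc₂]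

lemma mul_le_sqrt_stepsize_mul (hL : 0 < L) (hμ : 0 < μ) (hε : 0 < ε) (hc₁ : 0 ≤ c₁)
    (ha : c₁ * (σ ^ 4 * Λ ^ 2 / (L * μ * ε ^ 2)) ≤ a) :
    √c₁ * (σ ^ 2 * Λ) ≤ √(a * L / μ) * (μ * ε) := by
  rw [← div_le_iff₀ (by positivity)]
  refine Real.le_sqrt_of_sq_le ?_
  calc (√c₁ * (σ ^ 2 * Λ) / (μ * ε)) ^ 2 = c₁ * (σ ^ 4 * Λ ^ 2 / (L * μ * ε ^ 2)) * L / μ := by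
        rw [div_pow, mul_pow, Real.sq_sqrt hc₁]
        field_simp
    _ ≤ a * L / μ := by gcongr

lemma iterations_mul_runs_le (hL : 0 < L) (hμ : 0 < μ) (hσ : σ ≠ 0) (hε : 0 < ε) (hβ : 0 < β)
    (hc₂ : 0 < c₂) (hc₄ : 0 < c₄) (hτ : τ = ⌈Real.logb 2 (μ * R ^ 2 / (2 * ε))⌉₊)
    (hx : 1 < μ * R ^ 2 / (2 * ε)) (hℓ : 2 ≤ logFactor N₀ τ β)
    (ha : a ≤ c₂ * (σ ^ 4 * Real.log (N₀ * τ / β) ^ 2 / (L * μ * ε ^ 2)))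
    (hN : N₀ ≤ c₄ * √(a * L / μ)) {K : ℝ}
    (hK : c₄ * √c₂ / Real.log 2 * (2 * |Real.log (c₄ * √c₂ / Real.log 2)| + 2) ≤ K) :
    (N₀ : ℝ) * τ ≤ K * (σ ^ 2 / (μ * ε) * Real.log (μ * R ^ 2 / ε) *
        max 1 (Real.log (σ ^ 2 / (μ * ε * β) * Real.log (μ * R ^ 2 / ε)))) := by
  obtain ⟨hN₀, hτ₀⟩ := pos_of_logFactor_pos (two_pos.trans_le hℓ)
  have hΛ : 0 < Real.log (N₀ * τ / β) := by linarith [logFactor_le_four_mul_log hβ hℓ]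
  have hlog2 : 0 < Real.log 2 := Real.log_pos one_lt_two
  have htwo : 2 * (μ * R ^ 2 / (2 * ε)) = μ * R ^ 2 / ε := by field_simp
  have hlogpos : 0 < Real.log (μ * R ^ 2 / ε) := Real.log_pos (by linarith)
  have hruns : (τ : ℝ) ≤ Real.log (μ * R ^ 2 / ε) / Real.log 2 := by
    rw [le_div_iff₀ hlog2, hτ, ← htwo]
    exact ceil_logb_mul_log_le hx
  have hiter := hN.trans
    (mul_le_mul_of_nonneg_left (sqrt_stepsize_le hL hμ hε hc₂.le hΛ.le ha) hc₄.le)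
  have hprod : (N₀ : ℝ) * τ ≤ c₄ * √c₂ / Real.log 2 *
      (σ ^ 2 / (μ * ε) * Real.log (μ * R ^ 2 / ε)) * Real.log (N₀ * τ / β) := by
    refine (mul_le_mul hiter hruns (by positivity) (by positivity)).trans_eq ?_
    ring
  have hself := le_of_le_mul_log (by positivity) (by positivity) hβ (by positivity) hΛ hprod
  rw [mul_div_right_comm (σ ^ 2 / (μ * ε)), div_div (σ ^ 2)] at hself
  exact hself.trans (by gcongr)

lemma alpha_succ_le_div (hL : 0 < L) (ha : 0 < a) (hk : k < N₀) :
    alpha a L (k + 1) ≤ N₀ / (a * L) := by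
  have hk1 : (k : ℝ) + 1 ≤ N₀ := by exact_mod_cast hk
  rw [alpha_succ, mul_assoc, ← div_div]
  gcongr
  linarith [k.cast_nonneg (α := ℝ)]

lemma batchSize_le_two_add (hℓ : 2 ≤ logFactor N₀ τ β) :
    (batchSize L σ β R a N₀ τ t k : ℝ) ≤ 2 +
      6000 * 2 ^ t * σ ^ 2 * alpha a L (k + 1) ^ 2 * N₀ * logFactor N₀ τ β
        / (constC ^ 2 * R ^ 2) := by
  set b := 6000 * 2 ^ t * σ ^ 2 * alpha a L (k + 1) ^ 2 * N₀ * logFactor N₀ τ β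
    / (constC ^ 2 * R ^ 2) with hb
  have hb0 : 0 ≤ b := by positivity
  have hsecond : 10368 * 2 ^ t * σ ^ 2 * alpha a L (k + 1) ^ 2 * N₀ / (constC ^ 2 * R ^ 2) ≤ b := by
    rw [hb]
    gcongr ?_ / _
    calc 10368 * 2 ^ t * σ ^ 2 * alpha a L (k + 1) ^ 2 * N₀
        ≤ 12000 * 2 ^ t * σ ^ 2 * alpha a L (k + 1) ^ 2 * N₀ := by gcongr; norm_num
      _ = 6000 * 2 ^ t * σ ^ 2 * alpha a L (k + 1) ^ 2 * N₀ * 2 := by ring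
      _ ≤ 6000 * 2 ^ t * σ ^ 2 * alpha a L (k + 1) ^ 2 * N₀ * logFactor N₀ τ β := by gcongr
  have hmax := max_le (by linarith : (1 : ℝ) ≤ 1 + b)
    (max_le (by linarith : b ≤ 1 + b) (by linarith))
  refine (Nat.ceil_lt_add_one (zero_le_one.trans (le_max_left _ _))).le.trans ?_
  linarith

lemma batchSize_le (hL : 0 < L) (hμ : 0 < μ) (hε : 0 < ε) (hβ : 0 < β) (hR : 0 < R) (ha : 0 < a)
    (hc₁ : 0 < c₁) (hc₄ : 0 < c₄) (hℓ : 2 ≤ logFactor N₀ τ β)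
    (ha₁ : c₁ * (σ ^ 4 * Real.log (N₀ * τ / β) ^ 2 / (L * μ * ε ^ 2)) ≤ a)
    (hN : N₀ ≤ c₄ * √(a * L / μ)) (ht : (2 : ℝ) ^ t < μ * R ^ 2 / (2 * ε)) (hk : k < N₀) :
    (batchSize L σ β R a N₀ τ t k : ℝ) ≤ 2 + 2400 * c₄ ^ 3 / √c₁ := by
  have hℓΛ := logFactor_le_four_mul_log hβ hℓ
  have : 0 < logFactor N₀ τ β := two_pos.trans_le hℓ
  have hq1 := mul_le_sqrt_stepsize_mul hL hμ hε hc₁.le ha₁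
  have hq2 : a * L = √(a * L / μ) ^ 2 * μ := by
    rw [Real.sq_sqrt (by positivity)]
    field_simp
  have hα0 := alpha_succ_pos ha hL k
  have hα := alpha_succ_le_div hL ha hk
  set Λ := Real.log (N₀ * τ / β)
  have hΛ : 0 < Λ := by linarith
  have hq0 : 0 < √(a * L / μ) := by positivity
  set q := √(a * L / μ)
  refine (batchSize_le_two_add hℓ).trans (add_le_add_right ?_ 2)
  rw [sq_constC]
  calc 6000 * 2 ^ t * σ ^ 2 * alpha a L (k + 1) ^ 2 * N₀ * logFactor N₀ τ β / (5 * R ^ 2)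
      ≤ 6000 * (μ * R ^ 2 / (2 * ε)) * σ ^ 2 * (N₀ / (a * L)) ^ 2 * N₀ * (4 * Λ) / (5 * R ^ 2) := by
        gcongr
    _ = 2400 * μ * (σ ^ 2 * Λ) * N₀ ^ 3 / (ε * (a * L) ^ 2) := by
        field_simp
        ring
    _ ≤ 2400 * μ * (σ ^ 2 * Λ) * (c₄ * q) ^ 3 / (ε * (a * L) ^ 2) := by gcongr
    _ = 2400 * c₄ ^ 3 * (σ ^ 2 * Λ) / (q * (μ * ε)) := by
        rw [hq2]
        field_simp
    _ ≤ 2400 * c₄ ^ 3 / √c₁ := by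
        rw [div_le_div_iff₀ (by positivity) (by positivity), mul_assoc, mul_comm (σ ^ 2 * Λ)]
        gcongr

lemma half_mul_sq_div_two_pow_ceil_logb_le {μ ε R : ℝ} (hε : 0 < ε)
    (hx : 0 < μ * R ^ 2 / (2 * ε)) :
    μ * R ^ 2 / (2 * 2 ^ ⌈Real.logb 2 (μ * R ^ 2 / (2 * ε))⌉₊) ≤ ε := by
  have h := le_two_pow_ceil_logb hx
  rw [div_le_iff₀ (by positivity)] at h ⊢
  linarith

lemma forty_mul_le_sq_of_constC_mul_sqrt_le {a L μ : ℝ} {N₀ : ℕ} (hx : 0 ≤ 8 * a * L / μ)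
    (h : constC * √(8 * a * L / μ) ≤ N₀) : 40 * a * L / μ ≤ (N₀ : ℝ) ^ 2 := by
  have hsq := pow_le_pow_left₀ (mul_nonneg constC_pos.le (Real.sqrt_nonneg _)) h 2
  rw [mul_pow, sq_constC, Real.sq_sqrt hx] at hsq
  refine Eq.trans_le ?_ hsq
  ring

end Complexity

end ClippedSSTM

theorem mainTheorem5_general (c₁ c₂ c₄ : ℝ) (hc₁ : 0 < c₁) (hc₂ : 0 < c₂) (hc₄ : 0 < c₄) :
    ∃ K : ℝ, 0 < K ∧
      ∀ (n : ℕ) (S Ω : Type*) [MeasurableSpace S] [MeasurableSpace Ω]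
        (P : Measure Ω) [IsProbabilityMeasure P] (D : Measure S)
        (f : EuclideanSpace ℝ (Fin n) → ℝ)
        (G : EuclideanSpace ℝ (Fin n) → S → EuclideanSpace ℝ (Fin n))
        (ξ : ℕ → ℕ → ℕ → Ω → S)
        (x0 xstar : EuclideanSpace ℝ (Fin n))
        (L μ σ ε β R a : ℝ) (N₀ τ : ℕ),
        0 < L → 0 < μ → 0 < ε → 0 < β →
        ClippedSSTM.IsLSmooth f L → ClippedSSTM.IsStronglyConvex f 0 →
        (∀ x, μ / 2 * ‖x - xstar‖ ^ 2 ≤ f x - f xstar) →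
        ClippedSSTM.IsStochasticGradient f G D σ →
        (∀ t k i, Measurable (ξ t k i)) → (∀ t k i, P.map (ξ t k i) = D) →
        iIndepFun (fun j : ℕ × ℕ × ℕ => ξ j.1 j.2.1 j.2.2) P →
        R = √(2 * (f x0 - f xstar) / μ) →
        τ = ⌈Real.logb 2 (μ * R ^ 2 / (2 * ε))⌉₊ →
        2 ≤ ClippedSSTM.logFactor N₀ τ β →
        ClippedSSTM.constC * √(8 * a * L / μ) ≤ N₀ →
        ClippedSSTM.aLowerBound β N₀ τ ≤ a →
        c₁ * (σ ^ 4 * Real.log (N₀ * τ / β) ^ 2 / (L * μ * ε ^ 2)) ≤ a →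
        a ≤ c₂ * (σ ^ 4 * Real.log (N₀ * τ / β) ^ 2 / (L * μ * ε ^ 2)) →
        N₀ ≤ c₄ * √(a * L / μ) →
        1 - β ≤ P.real {ω | f (ClippedSSTM.restarted G L a N₀ (ClippedSSTM.clipParam β R N₀ τ)
            (ClippedSSTM.batchSize L σ β R a N₀ τ) (fun t k i => ξ t k i ω) x0 τ)
              - f xstar ≤ ε} ∧
        (N₀ : ℝ) * τ ≤ K * (σ ^ 2 / (μ * ε) * Real.log (μ * R ^ 2 / ε) *
            max 1 (Real.log (σ ^ 2 / (μ * ε * β) * Real.log (μ * R ^ 2 / ε)))) ∧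
        ∀ t < τ, ∀ k < N₀, (ClippedSSTM.batchSize L σ β R a N₀ τ t k : ℝ) ≤ K := by
  refine ⟨max (c₄ * √c₂ / Real.log 2 * (2 * |Real.log (c₄ * √c₂ / Real.log 2)| + 2))
    (2 + 2400 * c₄ ^ 3 / √c₁), lt_max_of_lt_right (by positivity), ?_⟩
  intro n S Ω _ _ P _ D f G ξ x0 xstar L μ σ ε β R a N₀ τ hL hμ hε hβ hf hconv hgrowth hG hξ hD
    hindep hR hτ hℓ hN ha ha₁ ha₂ hN₄
  have ha0 : 0 < a := one_pos.trans_le ((le_max_left _ _).trans ha)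
  have hσ : σ ≠ 0 := by rintro rfl; norm_num at ha₂; linarith
  have hx : 1 < μ * R ^ 2 / (2 * ε) := ClippedSSTM.one_lt_of_ceil_logb_pos (by positivity)
    (hτ ▸ (ClippedSSTM.pos_of_logFactor_pos (two_pos.trans_le hℓ)).2)
  have hRpos : 0 < R := (hR ▸ Real.sqrt_nonneg _ : 0 ≤ R).lt_of_ne' fun h => by norm_num [h] at hx
  have hgap : f x0 - f xstar = μ * R ^ 2 / 2 := by
    have h0 : 0 ≤ f x0 - f xstar := (by positivity : (0 : ℝ) ≤ _).trans (hgrowth x0)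
    rw [hR, Real.sq_sqrt (by positivity)]
    field_simp
  refine ⟨?_, ClippedSSTM.iterations_mul_runs_le hL hμ hσ hε hβ hc₂ hc₄ hτ hx hℓ ha₂ hN₄
    (le_max_left _ _), fun t ht k hk => ?_⟩
  · refine (ClippedSSTM.one_sub_le_measureReal_gap_restarted_le hf hconv hL hμ hgrowth hG hξ hD
      hindep hβ hRpos hgap.le hℓ (ClippedSSTM.forty_mul_le_sq_of_constC_mul_sqrt_le
        (by positivity) hN) ha).trans
      (measureReal_mono (Set.ofPred_subset_ofPred.2 fun ω hω => hω.trans ?_))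
    rw [hτ]
    exact ClippedSSTM.half_mul_sq_div_two_pow_ceil_logb_le hε (one_pos.trans hx)
  · exact (ClippedSSTM.batchSize_le hL hμ hε hβ hRpos ha0 hc₁ hc₄ hℓ ha₁ hN₄
      (ClippedSSTM.two_pow_lt_of_lt_ceil_logb (one_pos.trans hx) (hτ ▸ ht)) hk).trans
      (le_max_right _ _)

theorem mainTheorem5 (c₁ c₂ c₃ c₄ : ℝ) (hc₁ : 0 < c₁) (hc₂ : 0 < c₂) (hc₃ : 0 < c₃)
    (hc₄ : 0 < c₄) :
    ∃ K : ℝ, 0 < K ∧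
      ∀ (n : ℕ) (S Ω : Type*) [MeasurableSpace S] [MeasurableSpace Ω]
        (P : Measure Ω) [IsProbabilityMeasure P] (D : Measure S)
        (f : EuclideanSpace ℝ (Fin n) → ℝ)
        (G : EuclideanSpace ℝ (Fin n) → S → EuclideanSpace ℝ (Fin n))
        (ξ : ℕ → ℕ → ℕ → Ω → S)
        (x0 xstar : EuclideanSpace ℝ (Fin n))
        (L μ σ ε β R a : ℝ) (N₀ τ : ℕ),
        -- the problem
        0 < L → 0 < μ → 0 ≤ σ → 0 < ε → 0 < β → β < 1 →
        ClippedSSTM.IsLSmooth f L → ClippedSSTM.IsStronglyConvex f μ →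
        (∀ x, f xstar ≤ f x) →
        -- the stochastic gradients and the i.i.d. samples
        ClippedSSTM.IsStochasticGradient f G D σ →
        (∀ t k i, Measurable (ξ t k i)) → (∀ t k i, P.map (ξ t k i) = D) →
        iIndepFun (fun j : ℕ × ℕ × ℕ => ξ j.1 j.2.1 j.2.2) P →
        -- the parameters
        R = √(2 * (f x0 - f xstar) / μ) →
        τ = ⌈Real.logb 2 (μ * R ^ 2 / (2 * ε))⌉₊ →
        1 ≤ N₀ →
        2 ≤ ClippedSSTM.logFactor N₀ τ β →
        ClippedSSTM.constC * √(8 * a * L / μ) ≤ N₀ →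
        ClippedSSTM.aLowerBound β N₀ τ ≤ a →
        c₁ * (σ ^ 4 * Real.log (N₀ * τ / β) ^ 2 / (L * μ * ε ^ 2)) ≤ a →
        a ≤ c₂ * (σ ^ 4 * Real.log (N₀ * τ / β) ^ 2 / (L * μ * ε ^ 2)) →
        c₃ * √(a * L / μ) ≤ N₀ →
        N₀ ≤ c₄ * √(a * L / μ) →
        -- accuracy with high probability, total number of iterations, batchsizes
        1 - β ≤ P.real {ω | f (ClippedSSTM.restarted G L a N₀ (ClippedSSTM.clipParam β R N₀ τ)
            (ClippedSSTM.batchSize L σ β R a N₀ τ) (fun t k i => ξ t k i ω) x0 τ)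
              - f xstar ≤ ε} ∧
        (N₀ : ℝ) * τ ≤ K * (σ ^ 2 / (μ * ε) * Real.log (μ * R ^ 2 / ε) *
            max 1 (Real.log (σ ^ 2 / (μ * ε * β) * Real.log (μ * R ^ 2 / ε)))) ∧
        ∀ t < τ, ∀ k < N₀, (ClippedSSTM.batchSize L σ β R a N₀ τ t k : ℝ) ≤ K := by
  obtain ⟨K, hK, hmain⟩ := mainTheorem5_general c₁ c₂ c₄ hc₁ hc₂ hc₄
  exact ⟨K, hK, fun n S Ω _ _ P _ D f G ξ x0 xstar L μ σ ε β R a N₀ τ hL hμ _ hε hβ _ hf hconv hmin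
    hG hξ hD hindep hR hτ _ hℓ hN ha ha₁ ha₂ _ hN₄ =>
    hmain n S Ω P D f G ξ x0 xstar L μ σ ε β R a N₀ τ hL hμ hε hβ hf (hconv.mono hμ.le)
      (hconv.mul_sq_norm_sub_le hmin) hG hξ hD hindep hR hτ hℓ hN ha ha₁ ha₂ hN₄⟩
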